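/- Let $X$ be a Banach space over $\mathbb K\in\{\mathbb R,\mathbb C\}$ with closed unit ball $B_X$ and unit sphere $S_X$. A slice of $B_X$ is a set $\{x\in B_X:\operatorname{Re}x^*(x)>1-\varepsilon\}$ with $x^*\in S_{X^*}$, $\varepsilon>0$; a convex combination of slices (ccs) of $B_X$ is a set $\{\sum_{i=1}^n\lambda_i x_i: x_i\in S_i\}$ with slices $S_i$ of $B_X$, $\lambda_i>0$, $\sum_i\lambda_i=1$. A point $x\in S_X$ is called a Daugavet point (respectively a $\Delta$ point, a $\nabla$ point) if $\sup_{y\in S}\|x-y\|=2$ for every slice $S$ of $B_X$ (respectively every slice $S$ that contains $x$, every slice $S$ that does not contain $x$); a ccs-$\Delta$ point if $\sup_{y\in C}\|x-y\|=2$ for every ccs $C$ of $B_X$ that contains $x$; a super-Daugavet point if $\sup_{y\in W}\|x-y\|=2$ for every nonempty relatively weakly open subset $W$ of $B_X$. Theorem. Let $(\Omega,\Sigma,\mu)$ be any measure space, let $X$ be a Banach space, and let $f\in L_1(\mu,X)$ with $\|f\|=1$. An atom is a set $A\in\Sigma$ with $\mu(A)>0$ such that every measurable $B\subset A$ satisfies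 $\mu(B)=0$ or $\mu(A\setminus B)=0$. For an atom $A$ of finite measure, $g\mapsto\int_A g\,d\mu$ is a linear isometry of $L_1(\mu|_A,X)$ onto $X$, by which the two spaces are identified. Let $\operatorname{supp}(f)=\{\omega: f(\omega)\ne0\}$ (defined up to a null set, and inclusions in it are understood up to null sets); it is called atomless if it contains no atom. 1. If $\operatorname{supp}(f)$ is atomless, then $f$ is a super-Daugavet point and a ccs-$\Delta$ point of $L_1(\mu,X)$. 2. Otherwise, the following holds. (a) $f$ is a $\Delta$ point (respectively a Daugavet point) if and only if for every atom $A$ contained in $\operatorname{supp}(f)$ the function $\frac{f|_A}{\|f|_A\|}$ is a $\Delta$ point (respectively a Daugavet point) in $L_1(\mu|_A,X)=X$. (b) If $\mathbb K=\mathbb R$, then $f$ is a $\nabla$ point if and only if either $f$ is a Daugavet point, or there is an atom $A$ such that $f=0$ almost everywhere on $\Omega\setminus A$ and $f|_A$ is a $\nabla$ point in $L_1(\mu|_A,X)=X$. -/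

import Mathlib

open MeasureTheory Set

noncomputable section

namespace Diametral

/-! ### Slices, convex combinations of slices, relatively weakly open sets -/

section Points

variable (𝕜 : Type*) [RCLike 𝕜] {X : Type*} [NormedAddCommGroup X] [NormedSpace 𝕜 X]

/-- The set `S(A, φ, ε) = {x ∈ A : Re φ(x) > sup_{y ∈ A} Re φ(y) - ε}`. -/
def slice (A : Set X) (φ : X →L[𝕜] 𝕜) (ε : ℝ) : Set X :=
  {x | x ∈ A ∧ sSup ((fun y => RCLike.re (φ y)) '' A) - ε < RCLike.re (φ x)}

variable (X) in
/-- The closed unit ball `B_X`. -/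
abbrev unitBall : Set X := Metric.closedBall (0 : X) 1

/-- `S` is a slice of `B_X`, cut by a norm-one functional and some `ε > 0`. -/
def IsBallSlice (S : Set X) : Prop :=
  ∃ (φ : X →L[𝕜] 𝕜) (ε : ℝ), ‖φ‖ = 1 ∧ 0 < ε ∧ S = slice 𝕜 (unitBall X) φ ε

/-- `C` is a convex combination of slices of `B_X` with positive weights. -/
def IsBallCCS (C : Set X) : Prop :=
  ∃ (n : ℕ) (l : Fin n → ℝ) (S : Fin n → Set X),
    (∀ i, 0 < l i) ∧ ∑ i, l i = 1 ∧ (∀ i, IsBallSlice 𝕜 (S i)) ∧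
    C = {x | x ∈ unitBall X ∧
      ∃ y : Fin n → X, (∀ i, y i ∈ S i) ∧ x = ∑ i, ((l i : ℝ) : 𝕜) • y i}

/-- `W` is a subset of `B_X` that is open in the weak topology of `X` restricted to `B_X`. -/
def IsBallWeaklyOpen (W : Set X) : Prop :=
  ∃ U : Set (WeakSpace 𝕜 X), IsOpen U ∧ W = unitBall X ∩ (toWeakSpace 𝕜 X) ⁻¹' U

/-- `sup_{y ∈ S} ‖x - y‖ = 2`. -/
def ReachesTwo (x : X) (S : Set X) : Prop :=
  IsLUB ((fun y => ‖x - y‖) '' S) 2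

/-! ### Diametral points -/

/-- `x ∈ S_X` with `sup_{y ∈ W} ‖x - y‖ = 2` for all nonempty relatively weakly open
`W ⊆ B_X`. -/
def IsSuperDaugavetPoint (x : X) : Prop :=
  ‖x‖ = 1 ∧ ∀ W : Set X, IsBallWeaklyOpen 𝕜 W → W.Nonempty → ReachesTwo x W

/-- `x ∈ S_X` with `sup_{y ∈ S} ‖x - y‖ = 2` for all slices `S` of `B_X`. -/
def IsDaugavetPoint (x : X) : Prop :=
  ‖x‖ = 1 ∧ ∀ S : Set X, IsBallSlice 𝕜 S → ReachesTwo x S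

/-- `x ∈ S_X` with `sup_{y ∈ C} ‖x - y‖ = 2` for all convex combinations of slices `C` of `B_X`
that contain `x`. -/
def IsCCSDeltaPoint (x : X) : Prop :=
  ‖x‖ = 1 ∧ ∀ C : Set X, IsBallCCS 𝕜 C → x ∈ C → ReachesTwo x C

/-- `x ∈ S_X` with `sup_{y ∈ S} ‖x - y‖ = 2` for all slices `S` of `B_X` that contain `x`. -/
def IsDeltaPoint (x : X) : Prop :=
  ‖x‖ = 1 ∧ ∀ S : Set X, IsBallSlice 𝕜 S → x ∈ S → ReachesTwo x S

/-- `x ∈ S_X` with `sup_{y ∈ S} ‖x - y‖ = 2` for all slices `S` of `B_X` that do not contain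
`x`. -/
def IsNablaPoint (x : X) : Prop :=
  ‖x‖ = 1 ∧ ∀ S : Set X, IsBallSlice 𝕜 S → x ∉ S → ReachesTwo x S

/-- The normalized vector `x / ‖x‖`. -/
def normalized (x : X) : X := ((‖x‖⁻¹ : ℝ) : 𝕜) • x

end Points

/-! ### Atoms, supports and restrictions in `L_1(μ, X)` -/

section L1

variable {Ω : Type*} [MeasurableSpace Ω]

/-- `A` is an atom of `μ`: a measurable set of positive measure that does not split into two
measurable parts of positive measure. -/
structure IsAtomOf (μ : Measure Ω) (A : Set Ω) : Prop where
  measurableSet : MeasurableSet A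
  pos : 0 < μ A
  null_or_conull : ∀ B : Set Ω, MeasurableSet B → B ⊆ A → μ B = 0 ∨ μ (A \ B) = 0

variable {X : Type*} [NormedAddCommGroup X]

/-- `A` is an atom of `μ` contained in `supp(f) = {ω : f ω ≠ 0}`. The support is defined up to
a null set, and so is the inclusion. -/
def IsAtomInSupport {μ : Measure Ω} (f : Lp X 1 μ) (A : Set Ω) : Prop :=
  IsAtomOf μ A ∧ ∀ᵐ ω ∂μ, ω ∈ A → f ω ≠ 0

/-- The support of `f` contains no atom of `μ`. -/
def HasAtomlessSupport {μ : Measure Ω} (f : Lp X 1 μ) : Prop :=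
  ∀ A : Set Ω, ¬ IsAtomInSupport f A

variable (𝕜 : Type*) [RCLike 𝕜] [NormedSpace 𝕜 X]

/-- The restriction `f|_A`, an element of `L_1(μ|_A, X)`. -/
def restr {μ : Measure Ω} (f : Lp X 1 μ) (A : Set Ω) : Lp X 1 (μ.restrict A) :=
  LpToLpRestrictCLM Ω X 𝕜 μ 1 A f

/-- The map `L_1(μ|_A, X) → X`, `g ↦ ∫_A g dμ`. If `A` is an atom of finite measure, then `g` is
a.e. equal to a constant `x` on `A`, and the image of `g` is `μ(A) x`. The Bochner integral uses
the real scalar multiplication of `X` that comes from the one over `𝕜`. -/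
def atomValue {μ : Measure Ω} {A : Set Ω} (g : Lp X 1 (μ.restrict A)) : X :=
  letI : NormedSpace ℝ X := NormedSpace.restrictScalars ℝ 𝕜 X
  ∫ ω, g ω ∂(μ.restrict A)

end L1

end Diametral

end

/-! Everything rests on splitting `L_1(μ, X)` as a finite `ℓ_1`-sum by cutting `Ω` into pieces. By
`exists_partition_atoms_small` the pieces can be chosen so that each is an atom in the support of
`f` or carries very little of `f`. A function living on a few pieces where `f` is small is almost at
distance `‖f‖` plus its own norm from `f` (`le_norm_sub`).

If the support is atomless, all pieces are small. Carathéodory's theorem (`exists_sparse_weights`)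
reweights the pieces of a function so that only boundedly many survive, while finitely many
functionals and norms keep their values. The reweighted function stays in the given weakly open set
or convex combination of slices, and is far from `f`.

If there are atoms, a vector above the level `c` of `Φ`, in the homogeneous sense `c * ‖h‖ < Re
Φ(h)`, has a piece above that level. A small piece, normalized, is already far from `f`; a piece on
an atom `A` is replaced by a vector supplied by the hypothesis on `f|_A`
(`reachesTwoAbove_of_atoms`). Conversely, near-equality in the triangle inequality for an `ℓ_1`-norm
passes to each summand, so the properties of `f` descend to atoms. For a `∇` point with `‖f|_A‖ <
1`, high enough slices in `X` lift to slices that miss `f`, so the normalized restriction is even a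
Daugavet point; hence only an atom carrying all of `f` can fail to be Daugavet. -/

noncomputable section

namespace Diametral

/-! ### Diametral points through half-spaces of positive level, with unnormalized functionals. -/

section HalfSpaces

variable {𝕜 : Type*} [RCLike 𝕜] {X : Type*} [NormedAddCommGroup X] [NormedSpace 𝕜 X]

theorem re_apply_le (φ : X →L[𝕜] 𝕜) (x : X) : RCLike.re (φ x) ≤ ‖φ‖ * ‖x‖ :=
  (RCLike.re_le_norm _).trans (φ.le_opNorm x)

theorem exists_lt_re_apply {φ : X →L[𝕜] 𝕜} {c : ℝ} (hc : c < ‖φ‖) :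
    ∃ y : X, ‖y‖ ≤ 1 ∧ c < RCLike.re (φ y) := by
  obtain ⟨x, hx, hcx⟩ := φ.exists_lt_apply_of_lt_opNorm hc
  obtain ⟨u, hu, hux⟩ := RCLike.exists_norm_eq_mul_self (φ x)
  refine ⟨u • x, by rw [norm_smul, hu, one_mul]; exact hx.le, ?_⟩
  rw [map_smul, smul_eq_mul, ← hux, RCLike.ofReal_re]
  exact hcx

theorem sSup_re_unitBall (φ : X →L[𝕜] 𝕜) :
    sSup ((fun y => RCLike.re (φ y)) '' unitBall X) = ‖φ‖ := by
  refine csSup_eq_of_forall_le_of_forall_lt_exists_gt ?_ ?_ ?_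
  · exact ⟨_, 0, by simp, rfl⟩
  · rintro _ ⟨y, hy, rfl⟩
    have hy' : ‖y‖ ≤ 1 := by simpa using hy
    exact (re_apply_le φ y).trans (mul_le_of_le_one_right (norm_nonneg _) hy')
  · intro c hc
    obtain ⟨y, hy, hcy⟩ := exists_lt_re_apply hc
    exact ⟨_, ⟨y, by simpa using hy, rfl⟩, hcy⟩

theorem mem_slice_unitBall {φ : X →L[𝕜] 𝕜} (hφ : ‖φ‖ = 1) {ε : ℝ} {x : X} :
    x ∈ slice 𝕜 (unitBall X) φ ε ↔ ‖x‖ ≤ 1 ∧ 1 - ε < RCLike.re (φ x) := by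
  simp [slice, sSup_re_unitBall, hφ]

theorem reachesTwo_iff {x : X} (hx : ‖x‖ = 1) {S : Set X} (hS : ∀ y ∈ S, ‖y‖ ≤ 1) :
    ReachesTwo x S ↔ ∀ δ > 0, ∃ y ∈ S, 2 - δ < ‖x - y‖ := by
  constructor
  · intro h δ hδ
    obtain ⟨_, ⟨y, hy, rfl⟩, hlt, -⟩ := h.exists_between (show 2 - δ < 2 by linarith)
    exact ⟨y, hy, hlt⟩
  · intro h
    refine ⟨?_, fun b hb => ?_⟩
    · rintro _ ⟨y, hy, rfl⟩
      have := norm_sub_le x y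
      have := hS y hy
      simp only
      linarith
    · by_contra! hlt
      obtain ⟨y, hy, h2⟩ := h (2 - b) (by linarith)
      have := hb ⟨y, hy, rfl⟩
      simp only at this
      linarith

/-- The points of the part of `B_X` in the open half-space `{y : c < Re φ(y)}` have distances to
`x` arbitrarily close to `2`. -/
def ReachesTwoAbove (x : X) (φ : X →L[𝕜] 𝕜) (c : ℝ) : Prop :=
  ∀ δ > 0, ∃ y, ‖y‖ ≤ 1 ∧ c < RCLike.re (φ y) ∧ 2 - δ < ‖x - y‖

theorem ReachesTwoAbove.mono {x : X} {φ : X →L[𝕜] 𝕜} {c d : ℝ} (h : ReachesTwoAbove x φ d)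
    (hcd : c ≤ d) : ReachesTwoAbove x φ c := fun δ hδ =>
  let ⟨y, hy, hd, hxy⟩ := h δ hδ
  ⟨y, hy, hcd.trans_lt hd, hxy⟩

theorem reachesTwo_slice_iff {x : X} (hx : ‖x‖ = 1) {φ : X →L[𝕜] 𝕜} (hφ : ‖φ‖ = 1) {ε : ℝ} :
    ReachesTwo x (slice 𝕜 (unitBall X) φ ε) ↔ ReachesTwoAbove x φ (1 - ε) := by
  rw [reachesTwo_iff hx (fun y hy => ((mem_slice_unitBall hφ).1 hy).1)]
  simp only [mem_slice_unitBall hφ, ReachesTwoAbove, and_assoc]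

theorem norm_inv_smul_self {φ : X →L[𝕜] 𝕜} (hφ : 0 < ‖φ‖) :
    ‖((‖φ‖⁻¹ : ℝ) : 𝕜) • φ‖ = 1 := by
  rw [norm_smul, RCLike.norm_ofReal, abs_of_pos (inv_pos.2 hφ), inv_mul_cancel₀ hφ.ne']

theorem re_ofReal_smul_apply (φ : X →L[𝕜] 𝕜) (r : ℝ) (x : X) :
    RCLike.re (((r : 𝕜) • φ) x) = r * RCLike.re (φ x) := by
  rw [smul_apply, smul_eq_mul, RCLike.re_ofReal_mul]

theorem re_apply_ofReal_smul (φ : X →L[𝕜] 𝕜) (r : ℝ) (x : X) :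
    RCLike.re (φ ((r : 𝕜) • x)) = r * RCLike.re (φ x) := by
  rw [map_smul, smul_eq_mul, RCLike.re_ofReal_mul]

theorem reachesTwoAbove_inv_smul {x : X} {φ : X →L[𝕜] 𝕜} (hφ : 0 < ‖φ‖) {c : ℝ}
    (h : ReachesTwoAbove x (((‖φ‖⁻¹ : ℝ) : 𝕜) • φ) (‖φ‖⁻¹ * c)) : ReachesTwoAbove x φ c :=
  fun δ hδ =>
    let ⟨y, hy, hc, hxy⟩ := h δ hδ
    ⟨y, hy, lt_of_mul_lt_mul_left (by rwa [re_ofReal_smul_apply] at hc) (inv_nonneg.2 hφ.le), hxy⟩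

theorem isDaugavetPoint_iff {x : X} : IsDaugavetPoint 𝕜 x ↔
    ‖x‖ = 1 ∧ ∀ (φ : X →L[𝕜] 𝕜) (c : ℝ), 0 < c → c < ‖φ‖ → ReachesTwoAbove x φ c := by
  refine and_congr_right fun hx => ⟨fun h φ c hc0 hc => ?_, ?_⟩
  · have hφ : 0 < ‖φ‖ := hc0.trans hc
    have h1 : ‖φ‖⁻¹ * c < 1 := by rw [inv_mul_lt_iff₀ hφ]; simpa using hc
    refine reachesTwoAbove_inv_smul hφ ?_
    have := (reachesTwo_slice_iff hx (norm_inv_smul_self hφ)).1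
      (h _ ⟨_, 1 - ‖φ‖⁻¹ * c, norm_inv_smul_self hφ, by linarith, rfl⟩)
    simpa using this
  · rintro h _ ⟨φ, ε, hφ, hε, rfl⟩
    rw [reachesTwo_slice_iff hx hφ]
    -- A large `ε` gives a nonpositive level; passing to a smaller slice makes the level positive.
    exact (h φ (max (1 - ε) (1 / 2)) (by positivity)
      (by rw [hφ]; exact max_lt (by linarith) (by norm_num))).mono (le_max_left _ _)

theorem isNablaPoint_iff {x : X} : IsNablaPoint 𝕜 x ↔
    ‖x‖ = 1 ∧ ∀ (φ : X →L[𝕜] 𝕜) (c : ℝ), 0 < c → c < ‖φ‖ → RCLike.re (φ x) ≤ c →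
      ReachesTwoAbove x φ c := by
  refine and_congr_right fun hx => ⟨fun h φ c hc0 hc hxc => ?_, ?_⟩
  · have hφ : 0 < ‖φ‖ := hc0.trans hc
    have h1 : ‖φ‖⁻¹ * c < 1 := by rw [inv_mul_lt_iff₀ hφ]; simpa using hc
    refine reachesTwoAbove_inv_smul hφ ?_
    have := (reachesTwo_slice_iff hx (norm_inv_smul_self hφ)).1
      (h _ ⟨_, 1 - ‖φ‖⁻¹ * c, norm_inv_smul_self hφ, by linarith, rfl⟩ (by
        rw [mem_slice_unitBall (norm_inv_smul_self hφ), re_ofReal_smul_apply, not_and, not_lt]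
        intro
        have := mul_le_mul_of_nonneg_left hxc (inv_nonneg.2 hφ.le)
        linarith))
    simpa using this
  · rintro h _ ⟨φ, ε, hφ, hε, rfl⟩ hxS
    rw [reachesTwo_slice_iff hx hφ]
    rw [mem_slice_unitBall hφ, not_and, not_lt] at hxS
    exact (h φ (max (1 - ε) (1 / 2)) (by positivity)
      (by rw [hφ]; exact max_lt (by linarith) (by norm_num))
      ((hxS hx.le).trans (le_max_left _ _))).mono (le_max_left _ _)

theorem isDeltaPoint_iff {x : X} : IsDeltaPoint 𝕜 x ↔
    ‖x‖ = 1 ∧ ∀ (φ : X →L[𝕜] 𝕜) (c : ℝ), 0 < c → c < RCLike.re (φ x) →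
      ReachesTwoAbove x φ c := by
  refine and_congr_right fun hx => ⟨fun h φ c hc0 hc => ?_, ?_⟩
  · have hxφ : RCLike.re (φ x) ≤ ‖φ‖ := by simpa [hx] using re_apply_le φ x
    have hφ : 0 < ‖φ‖ := hc0.trans (hc.trans_le hxφ)
    have h1 : ‖φ‖⁻¹ * c < 1 := by
      rw [inv_mul_lt_iff₀ hφ]; simpa using hc.trans_le hxφ
    refine reachesTwoAbove_inv_smul hφ ?_
    have := (reachesTwo_slice_iff hx (norm_inv_smul_self hφ)).1
      (h _ ⟨_, 1 - ‖φ‖⁻¹ * c, norm_inv_smul_self hφ, by linarith, rfl⟩ (by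
        rw [mem_slice_unitBall (norm_inv_smul_self hφ), re_ofReal_smul_apply]
        refine ⟨hx.le, ?_⟩
        have := mul_lt_mul_of_pos_left hc (inv_pos.2 hφ)
        linarith))
    simpa using this
  · rintro h _ ⟨φ, ε, hφ, hε, rfl⟩ hxS
    rw [reachesTwo_slice_iff hx hφ]
    rw [mem_slice_unitBall hφ] at hxS
    -- add a large multiple of a functional that norms `x`, to make the level positive
    obtain ⟨ψ, hψ, hψx⟩ := exists_dual_vector'' 𝕜 x
    set t : ℝ := |1 - ε| + 1
    have ht : 0 < t := by positivity
    have hadd : ∀ y, RCLike.re ((φ + (t : 𝕜) • ψ) y) = RCLike.re (φ y) + t * RCLike.re (ψ y) := by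
      intro y
      rw [add_apply, map_add, re_ofReal_smul_apply]
    intro δ hδ
    obtain ⟨y, hy, hc, hxy⟩ := h (φ + (t : 𝕜) • ψ) (1 - ε + t)
      (by have := neg_abs_le (1 - ε); simp only [t]; linarith)
      (by rw [hadd, hψx, RCLike.ofReal_re, hx]; linarith [hxS.2]) δ hδ
    refine ⟨y, hy, ?_, hxy⟩
    rw [hadd] at hc
    have h1 : RCLike.re (ψ y) ≤ 1 :=
      (re_apply_le ψ y).trans (mul_le_one₀ hψ (norm_nonneg _) hy)
    nlinarith

end HalfSpaces

/-! ### Normalization and near-equality in the triangle inequality. -/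

section Normalized

variable {𝕜 : Type*} [RCLike 𝕜] {X : Type*} [NormedAddCommGroup X] [NormedSpace 𝕜 X]

theorem norm_normalized {x : X} (hx : x ≠ 0) : ‖normalized 𝕜 x‖ = 1 := by
  have := norm_pos_iff.2 hx
  rw [normalized, norm_smul, RCLike.norm_ofReal, abs_of_pos (inv_pos.2 this),
    inv_mul_cancel₀ this.ne']

theorem normalized_of_norm_eq_one {x : X} (hx : ‖x‖ = 1) : normalized 𝕜 x = x := by
  simp [normalized, hx]

theorem map_normalized {Y : Type*} [NormedAddCommGroup Y] [NormedSpace 𝕜 Y] (e : X ≃ₗᵢ[𝕜] Y)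
    (x : X) : e (normalized 𝕜 x) = normalized 𝕜 (e x) := by
  simp [normalized]

theorem re_apply_normalized (φ : X →L[𝕜] 𝕜) (x : X) :
    RCLike.re (φ (normalized 𝕜 x)) = ‖x‖⁻¹ * RCLike.re (φ x) :=
  re_apply_ofReal_smul φ _ x

theorem lt_re_apply_normalized {φ : X →L[𝕜] 𝕜} {x : X} {c : ℝ} (hx : x ≠ 0)
    (h : c * ‖x‖ < RCLike.re (φ x)) : c < RCLike.re (φ (normalized 𝕜 x)) := by
  rw [re_apply_normalized, lt_inv_mul_iff₀ (norm_pos_iff.2 hx), mul_comm]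
  exact h

theorem norm_normalized_sub_of_norm_le {x : X} (h1 : ‖x‖ ≤ 1) (hx : x ≠ 0) :
    ‖normalized 𝕜 x - x‖ = 1 - ‖x‖ := by
  have h0 := norm_pos_iff.2 hx
  have : normalized 𝕜 x - x = ((‖x‖⁻¹ - 1 : ℝ) : 𝕜) • x := by
    simp [normalized, sub_smul]
  rw [this, norm_smul, RCLike.norm_ofReal,
    abs_of_nonneg (by have := (one_le_inv₀ h0).2 h1; linarith), sub_mul, inv_mul_cancel₀ h0.ne',
    one_mul]

/-- With `u` the shorter vector, `u - v` is `‖u‖` times the difference of the unit vectors, plus a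
multiple of the second of norm `‖v‖ - ‖u‖`. The defect `δ * κ` therefore becomes at most `δ` after
division by `‖u‖ ≥ κ`. -/
theorem norm_normalized_sub_aux {u v : X} {δ κ : ℝ} (hκ : 0 < κ) (hδ : 0 < δ) (hu : κ ≤ ‖u‖)
    (huv : ‖u‖ ≤ ‖v‖) (h : ‖u‖ + ‖v‖ - δ * κ < ‖u - v‖) :
    2 - δ < ‖normalized 𝕜 u - normalized 𝕜 v‖ := by
  have hu0 : 0 < ‖u‖ := hκ.trans_le hu
  have hv0 : 0 < ‖v‖ := hu0.trans_le huv
  have key : u - v = ((‖u‖ : ℝ) : 𝕜) • (normalized 𝕜 u - normalized 𝕜 v)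
      + ((‖u‖ - ‖v‖ : ℝ) : 𝕜) • normalized 𝕜 v := by
    have e1 : ((‖u‖ : ℝ) : 𝕜) • normalized 𝕜 u = u := by
      rw [normalized, smul_smul, ← RCLike.ofReal_mul, mul_inv_cancel₀ hu0.ne']; simp
    have e2 : ((‖v‖ : ℝ) : 𝕜) • normalized 𝕜 v = v := by
      rw [normalized, smul_smul, ← RCLike.ofReal_mul, mul_inv_cancel₀ hv0.ne']; simp
    rw [smul_sub, e1, RCLike.ofReal_sub, sub_smul, e2]
    abel
  have h1 : ‖u - v‖ ≤ ‖u‖ * ‖normalized 𝕜 u - normalized 𝕜 v‖ + (‖v‖ - ‖u‖) := by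
    rw [key]
    refine (norm_add_le _ _).trans ?_
    rw [norm_smul, norm_smul, norm_normalized (norm_pos_iff.1 hv0), RCLike.norm_ofReal,
      RCLike.norm_ofReal, abs_of_pos hu0, abs_of_nonpos (by linarith)]
    linarith
  have h2 : δ * κ ≤ δ * ‖u‖ := mul_le_mul_of_nonneg_left hu hδ.le
  refine lt_of_mul_lt_mul_left (a := ‖u‖) ?_ hu0.le
  linarith

theorem norm_normalized_sub {u v : X} {δ κ : ℝ} (hκ : 0 < κ) (hδ : 0 < δ) (hu : κ ≤ ‖u‖)
    (hv : κ ≤ ‖v‖) (h : ‖u‖ + ‖v‖ - δ * κ < ‖u - v‖) :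
    2 - δ < ‖normalized 𝕜 u - normalized 𝕜 v‖ := by
  rcases le_total ‖u‖ ‖v‖ with huv | huv
  · exact norm_normalized_sub_aux hκ hδ hu huv h
  · rw [norm_sub_rev]
    exact norm_normalized_sub_aux hκ hδ hv huv (by rw [norm_sub_rev]; linarith)

end Normalized

/-! ### Passing diametral points to and from an `ℓ_1`-summand. -/

section Summand

variable {𝕜 : Type*} [RCLike 𝕜] {E : Type*} [NormedAddCommGroup E] [NormedSpace 𝕜 E]
  {Y : Type*} [NormedAddCommGroup Y] [NormedSpace 𝕜 Y]

/-- `P : E → Y` and `J : Y → E` present `Y` as a summand of `E` in an `ℓ_1`-direct sum. -/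
structure IsL1Summand (P : E →L[𝕜] Y) (J : Y →L[𝕜] E) : Prop where
  left_inv : ∀ y, P (J y) = y
  norm_eq : ∀ g, ‖g‖ = ‖P g‖ + ‖g - J (P g)‖

/-- The trivial summand: invariance under isometries becomes a case of the projection lemmas. -/
theorem isL1Summand_of_equiv (e : E ≃ₗᵢ[𝕜] Y) :
    IsL1Summand (e.toContinuousLinearEquiv : E →L[𝕜] Y)
      (e.symm.toContinuousLinearEquiv : Y →L[𝕜] E) where
  left_inv y := by simp
  norm_eq g := by simp

variable {P : E →L[𝕜] Y} {J : Y →L[𝕜] E} {f : E}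

namespace IsL1Summand

theorem norm_incl (h : IsL1Summand P J) (y : Y) : ‖J y‖ = ‖y‖ := by
  rw [h.norm_eq (J y), h.left_inv]; simp

theorem norm_proj_le (h : IsL1Summand P J) (g : E) : ‖P g‖ ≤ ‖g‖ := by
  have := norm_nonneg (g - J (P g))
  linarith [h.norm_eq g]

theorem norm_comp_incl_le (h : IsL1Summand P J) (φ : Y →L[𝕜] 𝕜) : ‖φ‖ ≤ ‖φ.comp P‖ := by
  refine φ.opNorm_le_bound (norm_nonneg _) fun y => ?_
  have := (φ.comp P).le_opNorm (J y)
  rwa [ContinuousLinearMap.comp_apply, h.left_inv, h.norm_incl] at this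

/-- The complementary parts of `f` and `g` contribute at most the sum of their norms to `‖f - g‖`,
so the whole defect bounds the defect between `P f` and `P g`. -/
theorem norm_normalized_proj_sub (h : IsL1Summand P J) (hf : ‖f‖ = 1) {g : E} (hg : ‖g‖ ≤ 1)
    {δ κ : ℝ} (hκ : 0 < κ) (hδ : 0 < δ) (hκf : κ ≤ ‖P f‖) (hκg : κ ≤ ‖P g‖)
    (hfg : 2 - δ * κ < ‖f - g‖) : 2 - δ < ‖normalized 𝕜 (P f) - normalized 𝕜 (P g)‖ := by
  refine norm_normalized_sub hκ hδ hκf hκg ?_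
  have h1 := h.norm_eq (f - g)
  have h2 : f - g - J (P (f - g)) = (f - J (P f)) - (g - J (P g)) := by
    simp only [map_sub]; abel
  have h3 := norm_sub_le (f - J (P f)) (g - J (P g))
  rw [h2, map_sub] at h1
  linarith [h.norm_eq f, h.norm_eq g]

theorem reachesTwoAbove_proj (h : IsL1Summand P J) (hf : ‖f‖ = 1) (hPf : P f ≠ 0)
    {φ : Y →L[𝕜] 𝕜} {c : ℝ} (hc : 0 < c) (hr : ReachesTwoAbove f (φ.comp P) c) :
    ReachesTwoAbove (normalized 𝕜 (P f)) φ c := by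
  have hlow : ∀ g : E, c < RCLike.re (φ.comp P g) → c < ‖φ‖ * ‖P g‖ := fun g hg =>
    hg.trans_le (re_apply_le φ (P g))
  have hφ : 0 < ‖φ‖ := by
    obtain ⟨g, -, hg, -⟩ := hr 1 one_pos
    exact pos_of_mul_pos_left (hc.trans (hlow g hg)) (norm_nonneg _)
  intro δ hδ
  -- Every `g` above the level satisfies `‖P g‖ ≥ c / ‖φ‖`, so this minimum bounds both projections
  -- below.
  have hκ : 0 < min ‖P f‖ (c / ‖φ‖) := lt_min (norm_pos_iff.2 hPf) (by positivity)
  obtain ⟨g, hg1, hg, hfg⟩ := hr (δ * min ‖P f‖ (c / ‖φ‖)) (by positivity)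
  have hPg : c / ‖φ‖ ≤ ‖P g‖ := by
    rw [div_le_iff₀ hφ, mul_comm]; exact (hlow g hg).le
  have hPg0 : P g ≠ 0 := norm_pos_iff.1 ((div_pos hc hφ).trans_le hPg)
  refine ⟨normalized 𝕜 (P g), (norm_normalized hPg0).le, lt_re_apply_normalized hPg0 ?_,
    h.norm_normalized_proj_sub hf hg1 hκ hδ (min_le_left _ _) ((min_le_right _ _).trans hPg) hfg⟩
  exact (mul_le_of_le_one_right hc.le ((h.norm_proj_le g).trans hg1)).trans_lt hg

/-- Normalizing `P f` moves it by `1 - ‖P f‖`, exactly the norm of the complementary part of `f`,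
which counts in full in `‖f - J y‖`. -/
theorem reachesTwoAbove_of_proj (h : IsL1Summand P J) (hf : ‖f‖ = 1) (hPf : P f ≠ 0)
    {Φ : E →L[𝕜] 𝕜} {c : ℝ} (hr : ReachesTwoAbove (normalized 𝕜 (P f)) (Φ.comp J) c) :
    ReachesTwoAbove f Φ c := by
  intro δ hδ
  obtain ⟨y, hy, hc, hxy⟩ := hr δ hδ
  refine ⟨J y, (h.norm_incl y).trans_le hy, hc, ?_⟩
  have h1 := h.norm_eq (f - J y)
  rw [map_sub, h.left_inv, map_sub, sub_sub_sub_cancel_right] at h1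
  have h2 := norm_normalized_sub_of_norm_le (𝕜 := 𝕜) ((h.norm_proj_le f).trans hf.le) hPf
  have h3 := norm_sub_le_norm_sub_add_norm_sub (normalized 𝕜 (P f)) (P f) y
  linarith [h.norm_eq f]

theorem isDeltaPoint_proj (h : IsL1Summand P J) (hPf : P f ≠ 0) (hf : IsDeltaPoint 𝕜 f) :
    IsDeltaPoint 𝕜 (normalized 𝕜 (P f)) := by
  rw [isDeltaPoint_iff] at hf ⊢
  obtain ⟨hf1, hf⟩ := hf
  refine ⟨norm_normalized hPf, fun φ c hc hcx δ hδ => ?_⟩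
  obtain ⟨ψ, hψ, hψf⟩ := exists_dual_vector'' 𝕜 (f - J (P f))
  have ha : 0 < ‖P f‖ := norm_pos_iff.2 hPf
  rw [re_apply_normalized, lt_inv_mul_iff₀ ha] at hcx
  set τ : ℝ := (RCLike.re (φ (P f)) - ‖P f‖ * c) / 2
  have hτ : 0 < τ := by simp only [τ]; linarith
  -- A slice containing `f` is needed. The second term gives `f` the value `c * (1 - ‖P f‖)` on its
  -- complement, so `Re Φ(f) = c + 2τ`; for other `g` in the ball it gives at most `c * (1 - ‖P
  -- g‖)`, so level `c + τ` forces `Re φ(P g) > c * ‖P g‖ + τ`.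
  set Φ : E →L[𝕜] 𝕜 :=
    φ.comp P + (c : 𝕜) • ψ.comp (ContinuousLinearMap.id 𝕜 E - J.comp P) with hΦ
  have hΦ_apply : ∀ g, RCLike.re (Φ g) =
      RCLike.re (φ (P g)) + c * RCLike.re (ψ (g - J (P g))) := by
    intro g
    rw [hΦ, add_apply, map_add, re_ofReal_smul_apply]
    rfl
  have hlow : ∀ g : E, ‖g‖ ≤ 1 → c + τ < RCLike.re (Φ g) →
      c * ‖P g‖ + τ < RCLike.re (φ (P g)) := by
    intro g hg hlt
    rw [hΦ_apply] at hlt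
    have h1 : RCLike.re (ψ (g - J (P g))) ≤ 1 - ‖P g‖ := by
      refine (re_apply_le ψ _).trans ((mul_le_of_le_one_left (norm_nonneg _) hψ).trans ?_)
      linarith [h.norm_eq g]
    have := mul_le_mul_of_nonneg_left h1 hc.le
    linarith
  have hlow' : ∀ g : E, ‖g‖ ≤ 1 → c + τ < RCLike.re (Φ g) → τ < ‖φ‖ * ‖P g‖ := by
    intro g hg hlt
    have h1 := hlow g hg hlt
    have h2 := re_apply_le φ (P g)
    have h3 : 0 ≤ c * ‖P g‖ := by positivity
    linarith
  have hfΦ : c + τ < RCLike.re (Φ f) := by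
    rw [hΦ_apply, hψf, RCLike.ofReal_re]
    have h1 := h.norm_eq f
    have h2 : ‖f - J (P f)‖ = 1 - ‖P f‖ := by linarith
    rw [h2]
    simp only [τ] at hτ ⊢
    linarith
  have hφ : 0 < ‖φ‖ :=
    pos_of_mul_pos_left (hτ.trans (hlow' f hf1.le hfΦ)) (norm_nonneg _)
  have hκ : 0 < min ‖P f‖ (τ / ‖φ‖) := lt_min ha (by positivity)
  obtain ⟨g, hg1, hg, hfg⟩ := hf Φ (c + τ) (by positivity) hfΦ
    (δ * min ‖P f‖ (τ / ‖φ‖)) (by positivity)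
  have hPg : τ / ‖φ‖ ≤ ‖P g‖ := by
    rw [div_le_iff₀ hφ, mul_comm]; exact (hlow' g hg1 hg).le
  have hPg0 : P g ≠ 0 := norm_pos_iff.1 ((div_pos hτ hφ).trans_le hPg)
  exact ⟨normalized 𝕜 (P g), (norm_normalized hPg0).le,
    lt_re_apply_normalized hPg0 (by linarith [hlow g hg1 hg]),
    h.norm_normalized_proj_sub hf1 hg1 hκ hδ (min_le_left _ _) ((min_le_right _ _).trans hPg) hfg⟩

theorem isDaugavetPoint_proj (h : IsL1Summand P J) (hPf : P f ≠ 0) (hf : IsDaugavetPoint 𝕜 f) :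
    IsDaugavetPoint 𝕜 (normalized 𝕜 (P f)) := by
  rw [isDaugavetPoint_iff] at hf ⊢
  exact ⟨norm_normalized hPf, fun φ c hc hcφ => h.reachesTwoAbove_proj hf.1 hPf hc
    (hf.2 _ c hc (hcφ.trans_le (h.norm_comp_incl_le φ)))⟩

theorem isDaugavetPoint_proj_of_isNablaPoint (h : IsL1Summand P J) (hPf : P f ≠ 0)
    (hPf1 : ‖P f‖ < 1) (hf : IsNablaPoint 𝕜 f) : IsDaugavetPoint 𝕜 (normalized 𝕜 (P f)) := by
  rw [isNablaPoint_iff] at hf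
  rw [isDaugavetPoint_iff]
  refine ⟨norm_normalized hPf, fun φ c hc hcφ => ?_⟩
  -- Above the level `‖φ‖ * ‖P f‖` the lifted slice misses `f`, so the `∇` property applies.
  have hmax : max c (‖φ‖ * ‖P f‖) < ‖φ‖ :=
    max_lt hcφ (mul_lt_of_lt_one_right (hc.trans hcφ) hPf1)
  have hmax0 : 0 < max c (‖φ‖ * ‖P f‖) := lt_max_of_lt_left hc
  exact (h.reachesTwoAbove_proj hf.1 hPf hmax0 (hf.2 _ _ hmax0
    (hmax.trans_le (h.norm_comp_incl_le φ))
    ((re_apply_le φ (P f)).trans (le_max_right _ _)))).mono (le_max_left _ _)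

theorem isNablaPoint_proj (h : IsL1Summand P J) (hPf : ‖P f‖ = 1) (hf : IsNablaPoint 𝕜 f) :
    IsNablaPoint 𝕜 (P f) := by
  rw [isNablaPoint_iff] at hf ⊢
  refine ⟨hPf, fun φ c hc hcφ hcf => ?_⟩
  have := h.reachesTwoAbove_proj hf.1 (norm_ne_zero_iff.1 (by rw [hPf]; exact one_ne_zero)) hc
    (hf.2 _ c hc (hcφ.trans_le (h.norm_comp_incl_le φ)) hcf)
  rwa [normalized_of_norm_eq_one hPf] at this

theorem lt_norm_comp_incl {Φ : E →L[𝕜] 𝕜} {c : ℝ} {v : Y}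
    (hv : c * ‖v‖ < RCLike.re (Φ (J v))) : c < ‖Φ.comp J‖ := by
  have := hv.trans_le (re_apply_le (Φ.comp J) v)
  exact lt_of_mul_lt_mul_right this (norm_nonneg _)

theorem isNablaPoint_of_proj (h : IsL1Summand P J) (hf : ‖f‖ = 1)
    (hPf : IsNablaPoint 𝕜 (P f)) : IsNablaPoint 𝕜 f := by
  rw [isNablaPoint_iff] at hPf ⊢
  obtain ⟨hPf1, hPf⟩ := hPf
  refine ⟨hf, fun Φ c hc hcΦ hfc => ?_⟩
  have hPf0 : P f ≠ 0 := norm_ne_zero_iff.1 (by rw [hPf1]; exact one_ne_zero)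
  have hfJ : J (P f) = f := by
    have := h.norm_eq f
    rw [hf, hPf1] at this
    have h0 : ‖f - J (P f)‖ = 0 := by linarith
    exact (sub_eq_zero.1 (norm_eq_zero.1 h0)).symm
  obtain ⟨z, hz, hcz⟩ := exists_lt_re_apply hcΦ
  -- One of the two parts of `z` lies above the level. If it is the complementary part, its
  -- normalization has distance exactly `2` from `f`, which lives in the summand.
  rcases lt_or_ge (c * ‖P z‖) (RCLike.re (Φ (J (P z)))) with hv | hv
  · refine h.reachesTwoAbove_of_proj hf hPf0 ?_
    rw [normalized_of_norm_eq_one hPf1]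
    refine hPf _ c hc (lt_norm_comp_incl hv) ?_
    rwa [ContinuousLinearMap.comp_apply, hfJ]
  · have hu : c * ‖z - J (P z)‖ < RCLike.re (Φ (z - J (P z))) := by
      rw [map_sub, map_sub]
      have h1 := h.norm_eq z
      have h2 : c * ‖z‖ ≤ c := mul_le_of_le_one_right hc.le hz
      rw [h1, mul_add] at h2
      linarith
    have hu0 : z - J (P z) ≠ 0 := by
      intro h0
      simp [h0] at hu
    have hPu : P (normalized 𝕜 (z - J (P z))) = 0 := by
      simp [normalized, h.left_inv]
    intro δ hδ
    refine ⟨normalized 𝕜 (z - J (P z)), (norm_normalized hu0).le,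
      lt_re_apply_normalized hu0 hu, ?_⟩
    have h1 := h.norm_eq (f - normalized 𝕜 (z - J (P z)))
    rw [map_sub, hPu, sub_zero, hfJ, sub_sub_cancel_left, norm_neg, norm_normalized hu0,
      hPf1] at h1
    linarith

end IsL1Summand

theorem IsDeltaPoint.map (e : E ≃ₗᵢ[𝕜] Y) {x : E} (hx : IsDeltaPoint 𝕜 x) :
    IsDeltaPoint 𝕜 (e x) := by
  have h1 : ‖e x‖ = 1 := by rw [e.norm_map, hx.1]
  have := (isL1Summand_of_equiv e).isDeltaPoint_proj (norm_ne_zero_iff.1 (by simp [hx.1])) hx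
  simpa [normalized_of_norm_eq_one h1] using this

theorem IsDaugavetPoint.map (e : E ≃ₗᵢ[𝕜] Y) {x : E} (hx : IsDaugavetPoint 𝕜 x) :
    IsDaugavetPoint 𝕜 (e x) := by
  have h1 : ‖e x‖ = 1 := by rw [e.norm_map, hx.1]
  have := (isL1Summand_of_equiv e).isDaugavetPoint_proj (norm_ne_zero_iff.1 (by simp [hx.1])) hx
  simpa [normalized_of_norm_eq_one h1] using this

theorem IsNablaPoint.map (e : E ≃ₗᵢ[𝕜] Y) {x : E} (hx : IsNablaPoint 𝕜 x) :
    IsNablaPoint 𝕜 (e x) := by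
  have h1 : ‖e x‖ = 1 := by rw [e.norm_map, hx.1]
  simpa using (isL1Summand_of_equiv e).isNablaPoint_proj (by simp [hx.1]) hx

theorem IsDaugavetPoint.isNablaPoint {x : E} (hx : IsDaugavetPoint 𝕜 x) : IsNablaPoint 𝕜 x :=
  ⟨hx.1, fun S hS _ => hx.2 S hS⟩

end Summand

/-! ### Finely decomposable points are super-Daugavet and ccs-`Δ` points. -/

section Decomposition

/-- Carathéodory's theorem for the conical hull of finitely many vectors, applied to their sum. -/
theorem exists_sparse_weights {ι F : Type*} [Fintype ι] [AddCommGroup F] [Module ℝ F]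
    [FiniteDimensional ℝ F] (v : ι → F) :
    ∃ (w : ι → ℝ) (t : Finset ι), (∀ i, 0 ≤ w i) ∧ (∀ i, i ∉ t → w i = 0) ∧
      t.card ≤ Module.finrank ℝ F + 1 ∧ ∑ i, w i • v i = ∑ i, v i := by
  classical
  rcases isEmpty_or_nonempty ι with hι | hι
  · exact ⟨0, ∅, by simp, by simp, by simp, by simp⟩
  have hN : (0 : ℝ) < Fintype.card ι := by exact_mod_cast Fintype.card_pos
  have hmem : Finset.univ.centerMass (fun _ => (1 : ℝ)) v ∈ convexHull ℝ (range v) :=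
    Finset.centerMass_mem_convexHull _ (by simp) (by simpa using hN) (by simp)
  obtain ⟨κ, _, z, w, hz, hind, hw, -, hsum⟩ := eq_pos_convex_span_of_mem_convexHull hmem
  choose p hp using fun k => hz (mem_range_self k)
  -- Carathéodory is applied to the average, hence the factor `card ι`; weights of equal indices are
  -- pooled.
  refine ⟨fun i => Fintype.card ι * ∑ k, if p k = i then w k else 0, Finset.univ.image p,
    fun i => ?_, fun i hi => ?_, ?_, ?_⟩
  · refine mul_nonneg hN.le (Finset.sum_nonneg fun k _ => ?_)
    split_ifs
    exacts [(hw k).le, le_rfl]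
  · beta_reduce
    rw [Finset.sum_eq_zero, mul_zero]
    intro k _
    rw [if_neg]
    rintro rfl
    exact hi (Finset.mem_image_of_mem p (Finset.mem_univ k))
  · refine Finset.card_image_le.trans ?_
    rw [Finset.card_univ]
    exact hind.card_le_finrank_succ.trans (Nat.add_le_add_right (Submodule.finrank_le _) 1)
  · have h1 : ∑ i, v i = (Fintype.card ι : ℝ) • ∑ k, w k • z k := by
      rw [hsum, Finset.centerMass]
      simp [smul_smul]
    rw [h1]
    simp only [mul_smul, ← Finset.smul_sum, Finset.sum_smul, ite_smul, zero_smul]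
    rw [Finset.sum_comm]
    simp [hp]

variable {𝕜 : Type*} [RCLike 𝕜] {E : Type*} [NormedAddCommGroup E] [NormedSpace 𝕜 E]

/-- The operators `R i` are the projections of a decomposition of `E` as a finite `ℓ_1`-direct
sum. -/
structure IsL1Decomposition {ι : Type*} [Fintype ι] (R : ι → E →L[𝕜] E) : Prop where
  sum_apply : ∀ g, ∑ i, R i g = g
  sum_norm : ∀ g, ∑ i, ‖R i g‖ = ‖g‖
  apply_self : ∀ i g, R i (R i g) = R i g
  apply_of_ne : ∀ i j, i ≠ j → ∀ g, R i (R j g) = 0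

namespace IsL1Decomposition

variable {ι : Type*} [Fintype ι] {R : ι → E →L[𝕜] E}

theorem apply_sum_smul (h : IsL1Decomposition R) (w : ι → 𝕜) (g : ι → E) (j : ι) :
    R j (∑ i, w i • R i (g i)) = w j • R j (g j) := by
  rw [map_sum, Finset.sum_eq_single j]
  · rw [map_smul, h.apply_self]
  · intro i _ hij
    rw [map_smul, h.apply_of_ne j i hij.symm, smul_zero]
  · simp

theorem norm_sum_smul (h : IsL1Decomposition R) {w : ι → ℝ} (hw : ∀ i, 0 ≤ w i) (g : E) :
    ‖∑ i, (w i : 𝕜) • R i g‖ = ∑ i, w i * ‖R i g‖ := by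
  rw [← h.sum_norm]
  refine Finset.sum_congr rfl fun j _ => ?_
  rw [h.apply_sum_smul (fun i => (w i : 𝕜)) (fun _ => g), norm_smul, RCLike.norm_ofReal,
    abs_of_nonneg (hw j)]

/-- If `G` lives on the summands indexed by `t`, then the norm of `f - G` is almost
`‖f‖ + ‖G‖`, provided that `f` is small there. -/
theorem le_norm_sub (h : IsL1Decomposition R) (f G : E) (t : Finset ι)
    (hG : ∀ i, i ∉ t → R i G = 0) : ‖f‖ + ‖G‖ - 2 * ∑ i ∈ t, ‖R i f‖ ≤ ‖f - G‖ := by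
  classical
  have h1 : ∑ i ∈ t, ‖R i f‖ = ∑ i, if i ∈ t then ‖R i f‖ else 0 := by simp
  rw [← h.sum_norm f, ← h.sum_norm G, ← h.sum_norm (f - G), h1, Finset.mul_sum,
    ← Finset.sum_add_distrib, ← Finset.sum_sub_distrib]
  refine Finset.sum_le_sum fun i _ => ?_
  rw [map_sub]
  split_ifs with hi
  · have := norm_sub_norm_le (R i G) (R i f)
    rw [norm_sub_rev] at this
    linarith
  · simp [hG i hi]

/-- Both sides are additive over the pieces. -/
theorem exists_lt_of_lt (h : IsL1Decomposition R) {φ : E →L[𝕜] 𝕜} {c : ℝ} {g : E}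
    (hg : c * ‖g‖ < RCLike.re (φ g)) : ∃ i, c * ‖R i g‖ < RCLike.re (φ (R i g)) := by
  by_contra! hle
  have h1 := Finset.sum_le_sum fun i (_ : i ∈ Finset.univ) => hle i
  rw [← Finset.mul_sum, h.sum_norm, ← map_sum, ← map_sum, h.sum_apply] at h1
  linarith

end IsL1Decomposition

/-- A basic weak neighbourhood restricts finitely many functionals only. -/
theorem exists_finset_of_isOpen_weakSpace {U : Set (WeakSpace 𝕜 E)} (hU : IsOpen U) {x : E}
    (hx : toWeakSpace 𝕜 E x ∈ U) : ∃ I : Finset (E →L[𝕜] 𝕜),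
      ∀ y, (∀ φ ∈ I, φ y = φ x) → toWeakSpace 𝕜 E y ∈ U := by
  obtain ⟨V, hV, rfl⟩ := isOpen_induced_iff.1 hU
  obtain ⟨I, u, hu, hI⟩ := isOpen_pi_iff.1 hV _ hx
  refine ⟨I, fun y hy => hI fun φ hφ => ?_⟩
  have h1 : φ x ∈ u φ := (hu φ hφ).2
  change φ y ∈ u φ
  rwa [hy φ hφ]

variable (𝕜) in
/-- `f` can be split into arbitrarily small pieces by decompositions of `E` as a finite
`ℓ_1`-direct sum. -/
def IsFinelyDecomposable (f : E) : Prop :=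
  ∀ η > 0, ∃ (ι : Type) (_ : Fintype ι) (R : ι → E →L[𝕜] E),
    IsL1Decomposition R ∧ ∀ i, ‖R i f‖ ≤ η

/-- Pieces of norm at most `η` summing to `1` in norm include more nonzero ones than there are
functionals, so some nontrivial combination of them is annihilated by all of `I`. -/
theorem IsL1Decomposition.exists_ne_zero_of_finset {ι : Type*} [Fintype ι] {R : ι → E →L[𝕜] E}
    (h : IsL1Decomposition R) {f : E} (hf : ‖f‖ = 1) (I : Finset (E →L[𝕜] 𝕜)) {η : ℝ}
    (hη : 0 < η) (hηI : (I.card + 1) * η ≤ 1) (hR : ∀ i, ‖R i f‖ ≤ η) :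
    ∃ (u : E) (t : Finset ι), u ≠ 0 ∧ t.card = I.card + 1 ∧ (∀ i, i ∉ t → R i u = 0) ∧
      ∀ φ ∈ I, φ u = 0 := by
  classical
  have hcard : I.card + 1 ≤ (Finset.univ.filter fun i => R i f ≠ 0).card := by
    have h1 : ∑ i ∈ Finset.univ.filter (fun i => R i f ≠ 0), ‖R i f‖ = 1 := by
      rw [← hf, ← h.sum_norm f]
      refine Finset.sum_subset (Finset.filter_subset _ _) fun i _ hi => ?_
      simpa using hi
    have h2 := Finset.sum_le_card_nsmul (Finset.univ.filter fun i => R i f ≠ 0)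
      (fun i => ‖R i f‖) η fun i _ => hR i
    rw [h1, nsmul_eq_mul] at h2
    have h3 := le_of_mul_le_mul_right (hηI.trans h2) hη
    exact_mod_cast h3
  obtain ⟨t, ht, htc⟩ := Finset.exists_subset_card_eq hcard
  let L : (t → 𝕜) →ₗ[𝕜] (I → 𝕜) :=
    LinearMap.pi fun φ => ∑ i : t, (φ.1 (R i f)) • LinearMap.proj i
  have hL : ∀ c φ, L c φ = ∑ i : t, φ.1 (R i f) * c i := by
    intro c φ
    simp [L]
  have hker : L.ker ≠ ⊥ := LinearMap.ker_ne_bot_of_finrank_lt (by simp [htc])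
  obtain ⟨c, hc, hc0⟩ := Submodule.exists_mem_ne_zero_of_ne_bot hker
  obtain ⟨j, hj⟩ := Function.ne_iff.1 hc0
  set w : ι → 𝕜 := fun i => if hi : i ∈ t then c ⟨i, hi⟩ else 0 with hw
  have hRu : ∀ i, R i (∑ i, w i • R i f) = w i • R i f := h.apply_sum_smul w fun _ => f
  refine ⟨∑ i, w i • R i f, t, fun h0 => ?_, htc, fun i hi => ?_, fun φ hφ => ?_⟩
  · have h1 := hRu j
    rw [h0, map_zero] at h1
    have h2 : w j = c j := by simp [hw]
    rw [h2, eq_comm, smul_eq_zero] at h1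
    exact h1.elim hj (Finset.mem_filter.1 (ht j.2)).2
  · rw [hRu]
    simp [hw, hi]
  · have h1 : L c ⟨φ, hφ⟩ = 0 := by rw [LinearMap.mem_ker.1 hc]; rfl
    rw [hL] at h1
    rw [map_sum, ← h1, ← Finset.sum_subset (Finset.subset_univ t), ← Finset.sum_coe_sort t]
    · refine Finset.sum_congr rfl fun i _ => ?_
      rw [map_smul, smul_eq_mul, mul_comm]
      simp [hw]
    · intro i _ hi
      simp [hw, hi]

theorem exists_norm_add_smul_eq_one {x u : E} (hx : ‖x‖ ≤ 1) (hu : u ≠ 0) :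
    ∃ s : ℝ, ‖x + (s : 𝕜) • u‖ = 1 := by
  have hu0 := norm_pos_iff.2 hu
  have hcont : Continuous fun s : ℝ => ‖x + (s : 𝕜) • u‖ := by
    have := RCLike.continuous_ofReal (K := 𝕜)
    fun_prop
  have h1 : (1 : ℝ) ∈ Icc ‖x + ((0 : ℝ) : 𝕜) • u‖ ‖x + ((2 / ‖u‖ : ℝ) : 𝕜) • u‖ := by
    refine ⟨by simpa using hx, ?_⟩
    have h2 := norm_sub_le (x + ((2 / ‖u‖ : ℝ) : 𝕜) • u) x
    rw [add_sub_cancel_left, norm_smul, RCLike.norm_ofReal, abs_of_pos (by positivity),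
      div_mul_cancel₀ _ hu0.ne'] at h2
    linarith
  obtain ⟨s, -, hs⟩ := intermediate_value_Icc (by positivity : 0 ≤ 2 / ‖u‖) hcont.continuousOn h1
  exact ⟨s, hs⟩

theorem IsFinelyDecomposable.isSuperDaugavetPoint {f : E} (hf : ‖f‖ = 1)
    (H : IsFinelyDecomposable 𝕜 f) : IsSuperDaugavetPoint 𝕜 f := by
  classical
  refine ⟨hf, ?_⟩
  rintro _ ⟨U, hU, rfl⟩ ⟨h, hh, hhU⟩
  rw [reachesTwo_iff hf (fun y hy => by simpa using hy.1)]
  intro δ hδ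
  have hh1 : ‖h‖ ≤ 1 := by simpa using hh
  obtain ⟨I, hI⟩ := exists_finset_of_isOpen_weakSpace hU hhU
  set d := Module.finrank ℝ ((I → 𝕜) × ℝ)
  -- The final vector lives on at most `N` pieces: `d + 1` from Carathéodory, `I.card + 1` from the
  -- correction `u`, which raises the norm to `1` without changing the functionals in `I`.
  set N : ℝ := (d + 1) + (I.card + 1)
  have hN : 0 < N := by positivity
  set η : ℝ := min (1 / (I.card + 1)) (δ / (4 * N))
  have hη : 0 < η := by positivity
  obtain ⟨ι, _, R, hR, hRf⟩ := H η hη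
  obtain ⟨u, t', hu0, ht', hut', hφu⟩ := hR.exists_ne_zero_of_finset hf I hη (by
    have : η ≤ 1 / (I.card + 1) := min_le_left _ _
    rwa [le_div_iff₀' (by positivity)] at this) hRf
  obtain ⟨w, t, hw, hwt, ht, hsum⟩ := exists_sparse_weights
    fun i => ((fun φ : I => φ.1 (R i h), ‖R i h‖) : (I → 𝕜) × ℝ)
  rw [Prod.ext_iff] at hsum
  simp only [Prod.fst_sum, Prod.snd_sum, Prod.smul_mk, smul_eq_mul, hR.sum_norm] at hsum
  set Th : E := ∑ i, (w i : 𝕜) • R i h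
  have hTh : ‖Th‖ = ‖h‖ := (hR.norm_sum_smul hw h).trans hsum.2
  have hφTh : ∀ φ ∈ I, φ Th = φ h := by
    intro φ hφ
    have h1 := congr_fun hsum.1 ⟨φ, hφ⟩
    simp only [Finset.sum_apply, Pi.smul_apply, RCLike.real_smul_eq_coe_mul, ← map_sum,
      hR.sum_apply] at h1
    rw [← h1, map_sum]
    simp
  obtain ⟨s, hs⟩ := exists_norm_add_smul_eq_one (𝕜 := 𝕜) (hTh.trans_le hh1) hu0
  refine ⟨Th + (s : 𝕜) • u, ⟨by simpa using hs.le, hI _ fun φ hφ => ?_⟩, ?_⟩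
  · change φ (Th + (s : 𝕜) • u) = φ h
    rw [map_add, map_smul, hφu φ hφ, smul_zero, add_zero, hφTh φ hφ]
  · have h1 := hR.le_norm_sub f (Th + (s : 𝕜) • u) (t ∪ t') fun i hi => by
      rw [Finset.mem_union, not_or] at hi
      rw [map_add, map_smul, hut' i hi.2, hR.apply_sum_smul (fun i => (w i : 𝕜)) (fun _ => h),
        hwt i hi.1]
      simp
    have h2 : ∑ i ∈ t ∪ t', ‖R i f‖ ≤ N * η := by
      refine (Finset.sum_le_card_nsmul _ _ η fun i _ => hRf i).trans ?_
      rw [nsmul_eq_mul]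
      refine mul_le_mul_of_nonneg_right ?_ hη.le
      have h3 := (Finset.card_union_le t t').trans (Nat.add_le_add ht ht'.le)
      simp only [N]
      exact_mod_cast h3
    have h3 : N * η ≤ δ / 4 := by
      refine (mul_le_mul_of_nonneg_left (min_le_right _ _) hN.le).trans_eq ?_
      field_simp
    rw [hf, hs] at h1
    linarith

theorem IsFinelyDecomposable.isCCSDeltaPoint {f : E} (hf : ‖f‖ = 1)
    (H : IsFinelyDecomposable 𝕜 f) : IsCCSDeltaPoint 𝕜 f := by
  classical
  refine ⟨hf, ?_⟩
  rintro _ ⟨n, l, S, hl, hl1, hS, rfl⟩ ⟨-, y, hy, hfy⟩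
  rw [reachesTwo_iff hf (fun y hy => by simpa using hy.1)]
  intro δ hδ
  choose φ ε hφ hε hSφ using hS
  set d := Module.finrank ℝ ((Fin n → 𝕜) × (Fin n → ℝ) × ℝ)
  obtain ⟨ι, _, R, hR, hRf⟩ := H (δ / (4 * (d + 1))) (by positivity)
  -- One linear reweighting must preserve every `φ j (y j)` and `‖y j‖`, to stay in the slices, and
  -- `‖f‖`, so that the image of `f` still has norm `1`.
  obtain ⟨w, t, hw, hwt, ht, hsum⟩ := exists_sparse_weights
    fun i => ((fun j => φ j (R i (y j)), fun j => ‖R i (y j)‖, ‖R i f‖) :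
      (Fin n → 𝕜) × (Fin n → ℝ) × ℝ)
  rw [Prod.ext_iff, Prod.ext_iff] at hsum
  simp only [Prod.fst_sum, Prod.snd_sum, Prod.smul_mk, smul_eq_mul, hR.sum_norm] at hsum
  obtain ⟨hs1, hs2, hs3⟩ := hsum
  set T : E → E := fun g => ∑ i, (w i : 𝕜) • R i g with hT
  have hTφ : ∀ j, φ j (T (y j)) = φ j (y j) := by
    intro j
    have h1 := congr_fun hs1 j
    simp only [Finset.sum_apply, Pi.smul_apply, RCLike.real_smul_eq_coe_mul, ← map_sum,
      hR.sum_apply] at h1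
    rw [← h1, hT, map_sum]
    simp
  have hTn : ∀ j, ‖T (y j)‖ = ‖y j‖ := by
    intro j
    have h1 := congr_fun hs2 j
    simp only [Finset.sum_apply, Pi.smul_apply, smul_eq_mul, hR.sum_norm] at h1
    exact (hR.norm_sum_smul hw _).trans h1
  have hTf : ‖T f‖ = 1 := by rw [← hf, ← hs3]; exact hR.norm_sum_smul hw f
  refine ⟨T f, ⟨by simpa using hTf.le, fun j => T (y j), fun j => ?_, ?_⟩, ?_⟩
  · have h1 := hy j
    rw [hSφ, mem_slice_unitBall (hφ j)] at h1 ⊢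
    rwa [hTn, hTφ]
  · simp only [hT]
    rw [hfy]
    simp only [map_sum, map_smul, Finset.smul_sum]
    rw [Finset.sum_comm]
    exact Finset.sum_congr rfl fun j _ => Finset.sum_congr rfl fun i _ => smul_comm _ _ _
  · have h1 := hR.le_norm_sub f (T f) t fun i hi => by
      rw [hT, hR.apply_sum_smul (fun i => (w i : 𝕜)) (fun _ => f), hwt i hi]
      simp
    have h2 : ∑ i ∈ t, ‖R i f‖ ≤ (d + 1) * (δ / (4 * (d + 1))) := by
      refine (Finset.sum_le_card_nsmul _ _ _ fun i _ => hRf i).trans ?_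
      rw [nsmul_eq_mul]
      refine mul_le_mul_of_nonneg_right ?_ (by positivity)
      exact_mod_cast ht
    have h3 : (d + 1) * (δ / (4 * (d + 1))) = δ / 4 := by field_simp
    rw [hf, hTf] at h1
    linarith

end Decomposition

/-! ### Partitions into atoms of the support and sets carrying little of `f`. -/

section Partition

variable {Ω : Type*} [MeasurableSpace Ω]

/-- `C` is the union of finitely many pairwise disjoint measurable sets satisfying `Q`. -/
def HasFinitePartition (Q : Set Ω → Prop) (C : Set Ω) : Prop :=
  ∃ (ι : Type) (_ : Fintype ι) (P : ι → Set Ω), (∀ i, MeasurableSet (P i)) ∧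
    Pairwise (Function.onFun Disjoint P) ∧ ⋃ i, P i = C ∧ ∀ i, Q (P i)

theorem HasFinitePartition.of_self {Q : Set Ω → Prop} {C : Set Ω} (hC : MeasurableSet C)
    (hQ : Q C) : HasFinitePartition Q C :=
  ⟨Unit, inferInstance, fun _ => C, fun _ => hC, fun i j h => (h (Subsingleton.elim i j)).elim,
    iUnion_const C, fun _ => hQ⟩

theorem HasFinitePartition.union {Q : Set Ω → Prop} {C D : Set Ω} (hC : HasFinitePartition Q C)
    (hD : HasFinitePartition Q D) (hCD : Disjoint C D) : HasFinitePartition Q (C ∪ D) := by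
  obtain ⟨ι, _, P, hPm, hPd, rfl, hP⟩ := hC
  obtain ⟨κ, _, R, hRm, hRd, rfl, hR⟩ := hD
  have hPR : ∀ i j, Disjoint (P i) (R j) := fun i j =>
    hCD.mono (subset_iUnion P i) (subset_iUnion R j)
  refine ⟨ι ⊕ κ, inferInstance, Sum.elim P R, ?_, ?_, ?_, ?_⟩
  · rintro (i | i)
    exacts [hPm i, hRm i]
  · rintro (i | i) (j | j) hij
    · exact hPd fun h => hij (h ▸ rfl)
    · exact hPR i j
    · exact (hPR j i).symm
    · exact hRd fun h => hij (h ▸ rfl)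
  · exact iUnion_sumElim P R
  · rintro (i | i)
    exacts [hP i, hR i]

theorem HasFinitePartition.union_diff {Q : Set Ω → Prop} {C D : Set Ω} (hDC : D ⊆ C)
    (hD : HasFinitePartition Q D) (hCD : HasFinitePartition Q (C \ D)) :
    HasFinitePartition Q C := by
  simpa [union_sdiff_cancel hDC] using hD.union hCD disjoint_sdiff_right

/-- If small sets satisfy `Q`, and every other measurable set either is partitioned into sets that
satisfy `Q` or splits into two parts of positive measure, then every measurable set is partitioned
into finitely many sets that satisfy `Q`. -/
theorem hasFinitePartition_of_split {ν : Measure Ω} [IsFiniteMeasure ν] {Q : Set Ω → Prop}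
    {η : ENNReal} (hη : 0 < η) (hsmall : ∀ C, ν C ≤ η → Q C)
    (hsplit : ∀ C, MeasurableSet C → HasFinitePartition Q C ∨
      ∃ B ⊆ C, MeasurableSet B ∧ 0 < ν B ∧ 0 < ν (C \ B)) {C : Set Ω} (hC : MeasurableSet C) :
    HasFinitePartition Q C := by
  by_contra hbad
  -- Exhaustion: nested bad sets of nearly minimal measure have as intersection a bad set `K` of
  -- least measure among its bad subsets.
  let Bad := {D : Set Ω // MeasurableSet D ∧ ¬ HasFinitePartition Q D}
  have hstep : ∀ (ε : ENNReal) (D : Bad), 0 < ε → ∃ D' : Bad, D'.1 ⊆ D.1 ∧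
      ∀ D'' : Bad, D''.1 ⊆ D.1 → ν D'.1 ≤ ν D''.1 + ε := by
    intro ε D hε
    set S : Set ENNReal := (fun D' : Bad => ν D'.1) '' {D' | D'.1 ⊆ D.1}
    have hDS : ν D.1 ∈ S := ⟨D, Subset.refl D.1, rfl⟩
    have hfin : sInf S ≠ ⊤ := ((sInf_le hDS).trans_lt (measure_lt_top ν D.1)).ne
    obtain ⟨_, ⟨D', hD', rfl⟩, hlt⟩ := sInf_lt_iff.1 (ENNReal.lt_add_right hfin hε.ne')
    refine ⟨D', hD', fun D'' hD'' => hlt.le.trans ?_⟩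
    gcongr
    exact sInf_le ⟨D'', hD'', rfl⟩
  choose! next hnext hmin using hstep
  -- For `n = 0` the inverse is `⊤`, which imposes nothing on the first choice.
  have hpos : ∀ n : ℕ, (0 : ENNReal) < (n : ENNReal)⁻¹ := fun n => by simp
  let s : ℕ → Bad := fun n => Nat.rec (motive := fun _ => Bad) ⟨C, hC, hbad⟩ (fun k D => next (k : ENNReal)⁻¹ D) n
  have hs : ∀ n, s (n + 1) = next (n : ENNReal)⁻¹ (s n) := fun n => rfl
  have hanti : Antitone fun n => (s n).1 := antitone_nat_of_succ_le fun n => by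
    rw [hs]; exact hnext _ _ (hpos n)
  set K : Set Ω := ⋂ n, (s n).1
  have hK : MeasurableSet K := MeasurableSet.iInter fun n => (s n).2.1
  have hKs : ∀ n, K ⊆ (s n).1 := fun n => iInter_subset _ n
  have hlim := tendsto_measure_iInter_atTop (μ := ν) (s := fun n => (s n).1)
    (fun n => (s n).2.1.nullMeasurableSet) hanti ⟨0, measure_ne_top _ _⟩
  -- Late sets of the sequence exceed `K` by measure at most `η`, so a partition of `K` would extend
  -- to them.
  have hKbad : ¬ HasFinitePartition Q K := by
    intro hgood
    obtain ⟨n, hn⟩ := (hlim.eventually_lt_const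
      (ENNReal.lt_add_right (measure_ne_top ν K) hη.ne')).exists
    refine (s n).2.2 (hgood.union_diff (hKs n)
      (HasFinitePartition.of_self ((s n).2.1.diff hK) (hsmall _ ?_)))
    rw [measure_sdiff (hKs n) hK.nullMeasurableSet (measure_ne_top _ _), tsub_le_iff_left]
    exact hn.le
  have hle : ∀ D : Set Ω, D ⊆ K → MeasurableSet D → ¬ HasFinitePartition Q D → ν K ≤ ν D := by
    intro D hDK hD hDbad
    have h1 : Filter.Tendsto (fun n : ℕ => ν D + (n : ENNReal)⁻¹) Filter.atTop (nhds (ν D)) := by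
      simpa using ENNReal.tendsto_inv_nat_nhds_zero.const_add (ν D)
    refine ge_of_tendsto' h1 fun n => (measure_mono (hKs (n + 1))).trans ?_
    rw [hs]
    exact hmin _ _ (hpos n) ⟨D, hD, hDbad⟩ (hDK.trans (hKs n))
  obtain ⟨B, hBK, hB, hB0, hB1⟩ := (hsplit K hK).resolve_left hKbad
  have hadd : ν B + ν (K \ B) = ν K := by
    rw [← measure_sdiff_add_inter K hB, inter_eq_self_of_subset_right hBK, add_comm]
  -- One of the two parts of `K` is bad and has strictly smaller measure.
  by_cases hBQ : HasFinitePartition Q B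
  · have h1 := hle (K \ B) sdiff_subset (hK.diff hB) fun h => hKbad (hBQ.union_diff hBK h)
    rw [← hadd, add_comm] at h1
    exact h1.not_gt (ENNReal.lt_add_right (measure_ne_top _ _) hB0.ne')
  · have h1 := hle B hBK hB hBQ
    rw [← hadd] at h1
    exact h1.not_gt (ENNReal.lt_add_right (measure_ne_top _ _) hB1.ne')

variable {X : Type*} [NormedAddCommGroup X] {μ : Measure Ω}

/-- The measure `‖f‖ dμ` is finite for arbitrary `μ`, and on subsets of the support it has the same
null sets as `μ`; exhaustion is run on it. -/
theorem exists_partition_atoms_small (f : Lp X 1 μ) {η : ENNReal} (hη : 0 < η) :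
    HasFinitePartition (fun C => ∫⁻ ω in C, ‖f ω‖ₑ ∂μ ≤ η ∨ IsAtomInSupport f C) univ := by
  have hfm : Measurable fun ω => ‖f ω‖ₑ := (Lp.stronglyMeasurable f).enorm
  have hfin : ∫⁻ ω, ‖f ω‖ₑ ∂μ ≠ ⊤ := (L1.integrable_coeFn f).2.ne
  have := isFiniteMeasure_withDensity hfin
  set ν := μ.withDensity fun ω => ‖f ω‖ₑ with hν
  have hνle : ∀ C, ∫⁻ ω in C, ‖f ω‖ₑ ∂μ ≤ ν C := withDensity_apply_le _
  have hS : MeasurableSet (Function.support f) :=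
    (Lp.stronglyMeasurable f).measurableSet_support
  have hνS : ∀ C, ν C = 0 ↔ μ (Function.support f ∩ C) = 0 := by
    intro C
    rw [hν, withDensity_apply_eq_zero hfm]
    simp [Function.support]
  have hνpos : ∀ C ⊆ Function.support f, μ C ≠ 0 → 0 < ν C := by
    intro C hC h0
    rw [pos_iff_ne_zero, Ne, hνS, inter_eq_self_of_subset_right hC]
    exact h0
  refine hasFinitePartition_of_split (ν := ν) hη (fun C hC => Or.inl ((hνle C).trans hC)) ?_
    MeasurableSet.univ
  intro C hC
  by_cases hatom : IsAtomOf μ (C ∩ Function.support f)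
  · left
    refine HasFinitePartition.union_diff (inter_subset_left (t := Function.support f))
      (.of_self (hC.inter hS) (Or.inr ⟨hatom, .of_forall fun ω hω => hω.2⟩))
      (.of_self (hC.diff (hC.inter hS)) (Or.inl ?_))
    refine (hνle _).trans (le_of_eq_of_le ?_ hη.le)
    rw [hνS]
    convert measure_empty (μ := μ)
    ext ω
    simp only [mem_inter_iff, mem_sdiff, mem_empty_iff_false, iff_false]
    tauto
  · by_cases h0 : μ (C ∩ Function.support f) = 0
    · left
      refine .of_self hC (Or.inl ((hνle _).trans (le_of_eq_of_le ?_ hη.le)))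
      rwa [hνS, inter_comm]
    · right
      obtain ⟨B, hB, hBC, hB0, hB1⟩ : ∃ B, MeasurableSet B ∧ B ⊆ C ∩ Function.support f ∧
          μ B ≠ 0 ∧ μ ((C ∩ Function.support f) \ B) ≠ 0 := by
        by_contra! hall
        refine hatom ⟨hC.inter hS, pos_iff_ne_zero.2 h0, fun B hB hBC => ?_⟩
        exact or_iff_not_imp_left.2 (hall B hB hBC)
      refine ⟨B, hBC.trans inter_subset_left, hB, hνpos B (hBC.trans inter_subset_right) hB0,
        (hνpos _ (sdiff_subset.trans inter_subset_right) hB1).trans_le (measure_mono ?_)⟩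
      exact sdiff_subset_sdiff_left inter_subset_left

end Partition

/-! ### Cutting functions to measurable sets. -/

section Cut

variable {Ω : Type*} [MeasurableSpace Ω] {μ : Measure Ω} {X : Type*} [NormedAddCommGroup X]

variable (𝕜 : Type*) [RCLike 𝕜] [NormedSpace 𝕜 X]

/-- The linear map `g ↦ 1_A g` on `L_1(μ, X)`. -/
def cutLM {A : Set Ω} (hA : MeasurableSet A) : Lp X 1 μ →ₗ[𝕜] Lp X 1 μ where
  toFun g := ((Lp.memLp g).indicator hA).toLp _
  map_add' g h := by
    refine Lp.ext ?_
    filter_upwards [((Lp.memLp (g + h)).indicator hA).coeFn_toLp,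
      ((Lp.memLp g).indicator hA).coeFn_toLp, ((Lp.memLp h).indicator hA).coeFn_toLp,
      Lp.coeFn_add g h, Lp.coeFn_add (((Lp.memLp g).indicator hA).toLp _)
        (((Lp.memLp h).indicator hA).toLp _)] with ω h1 h2 h3 h4 h5
    rw [h1, h5, Pi.add_apply, h2, h3]
    by_cases hω : ω ∈ A
    · rw [indicator_of_mem hω, indicator_of_mem hω, indicator_of_mem hω, h4, Pi.add_apply]
    · simp [hω]
  map_smul' c g := by
    refine Lp.ext ?_
    filter_upwards [((Lp.memLp (c • g)).indicator hA).coeFn_toLp,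
      ((Lp.memLp g).indicator hA).coeFn_toLp, Lp.coeFn_smul c g,
      Lp.coeFn_smul c (((Lp.memLp g).indicator hA).toLp _)] with ω h1 h2 h3 h4
    rw [RingHom.id_apply, h1, h4, Pi.smul_apply, h2]
    by_cases hω : ω ∈ A
    · rw [indicator_of_mem hω, indicator_of_mem hω, h3, Pi.smul_apply]
    · simp [hω]

theorem cutLM_coeFn {A : Set Ω} (hA : MeasurableSet A) (g : Lp X 1 μ) :
    cutLM 𝕜 hA g =ᵐ[μ] A.indicator g :=
  ((Lp.memLp g).indicator hA).coeFn_toLp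

theorem norm_cutLM {A : Set Ω} (hA : MeasurableSet A) (g : Lp X 1 μ) :
    ‖cutLM 𝕜 hA g‖ = ∫ ω in A, ‖g ω‖ ∂μ := by
  rw [L1.norm_eq_integral_norm, ← integral_indicator hA]
  refine integral_congr_ae ?_
  filter_upwards [cutLM_coeFn 𝕜 hA g] with ω hω
  rw [hω, norm_indicator_eq_indicator_norm]

/-- The continuous linear map `g ↦ 1_A g` on `L_1(μ, X)`. -/
def cut {A : Set Ω} (hA : MeasurableSet A) : Lp X 1 μ →L[𝕜] Lp X 1 μ :=
  (cutLM 𝕜 hA).mkContinuous 1 fun g => by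
    rw [norm_cutLM, one_mul, L1.norm_eq_integral_norm]
    exact setIntegral_le_integral (L1.integrable_coeFn g).norm
      (.of_forall fun _ => norm_nonneg _)

theorem cut_coeFn {A : Set Ω} (hA : MeasurableSet A) (g : Lp X 1 μ) :
    cut 𝕜 hA g =ᵐ[μ] A.indicator g :=
  cutLM_coeFn 𝕜 hA g

theorem norm_cut {A : Set Ω} (hA : MeasurableSet A) (g : Lp X 1 μ) :
    ‖cut 𝕜 hA g‖ = ∫ ω in A, ‖g ω‖ ∂μ :=
  norm_cutLM 𝕜 hA g

theorem norm_cut_eq_toReal {A : Set Ω} (hA : MeasurableSet A) (g : Lp X 1 μ) :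
    ‖cut 𝕜 hA g‖ = (∫⁻ ω in A, ‖g ω‖ₑ ∂μ).toReal := by
  rw [norm_cut, integral_norm_eq_lintegral_enorm
    (L1.integrable_coeFn g).aestronglyMeasurable.restrict]

theorem cut_cut {A B : Set Ω} (hA : MeasurableSet A) (hB : MeasurableSet B) (g : Lp X 1 μ) :
    cut 𝕜 hA (cut 𝕜 hB g) = cut 𝕜 (hA.inter hB) g := by
  refine Lp.ext ?_
  filter_upwards [cut_coeFn 𝕜 hA (cut 𝕜 hB g), cut_coeFn 𝕜 hB g,
    cut_coeFn 𝕜 (hA.inter hB) g] with ω h1 h2 h3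
  rw [h1, h3]
  by_cases hω : ω ∈ A <;> by_cases hω' : ω ∈ B <;> simp [hω, hω', h2]

theorem isL1Decomposition_cut {ι : Type*} [Fintype ι] {P : ι → Set Ω}
    (hP : ∀ i, MeasurableSet (P i)) (hd : Pairwise (Function.onFun Disjoint P))
    (hU : ⋃ i, P i = univ) :
    IsL1Decomposition fun i => (cut 𝕜 (hP i) : Lp X 1 μ →L[𝕜] Lp X 1 μ) := by
  have hnorm : ∀ g : Lp X 1 μ, ∑ i, ‖cut 𝕜 (hP i) g‖ = ‖g‖ := by
    intro g
    have h1 := integral_iUnion_fintype hP hd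
      fun i => ((L1.integrable_coeFn g).norm.integrableOn (s := P i))
    rw [hU, Measure.restrict_univ, ← L1.norm_eq_integral_norm] at h1
    simp only [norm_cut, h1]
  have hself : ∀ i (g : Lp X 1 μ), cut 𝕜 (hP i) (cut 𝕜 (hP i) g) = cut 𝕜 (hP i) g := by
    intro i g
    rw [cut_cut]
    congr
    exact inter_self _
  have hne : ∀ i j, i ≠ j → ∀ g : Lp X 1 μ, cut 𝕜 (hP i) (cut 𝕜 (hP j) g) = 0 := by
    intro i j hij g
    rw [cut_cut, ← norm_eq_zero, norm_cut, (hd hij).inter_eq]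
    simp
  refine ⟨fun g => ?_, hnorm, hself, hne⟩
  -- The difference is killed by every cut, and its norm is the sum of the norms of its cuts.
  rw [← sub_eq_zero, ← norm_eq_zero, ← hnorm]
  refine Finset.sum_eq_zero fun j _ => ?_
  rw [map_sub, map_sum, Finset.sum_eq_single j (fun i _ hij => hne j i hij.symm g) (by simp),
    hself, sub_self, norm_zero]

theorem norm_eq_norm_cut_add {A : Set Ω} (hA : MeasurableSet A) (g : Lp X 1 μ) :
    ‖g‖ = ‖cut 𝕜 hA g‖ + ‖g - cut 𝕜 hA g‖ := by
  have h1 : g - cut 𝕜 hA g = cut 𝕜 hA.compl g := by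
    refine Lp.ext ?_
    filter_upwards [Lp.coeFn_sub g (cut 𝕜 hA g), cut_coeFn 𝕜 hA g,
      cut_coeFn 𝕜 hA.compl g] with ω h1 h2 h3
    rw [h1, h3, Pi.sub_apply, h2]
    by_cases hω : ω ∈ A <;> simp [hω]
  rw [h1, norm_cut, norm_cut, L1.norm_eq_integral_norm,
    integral_add_compl hA (L1.integrable_coeFn g).norm]

theorem restr_coeFn (g : Lp X 1 μ) (A : Set Ω) : restr 𝕜 g A =ᵐ[μ.restrict A] g :=
  LpToLpRestrictCLM_coeFn 𝕜 A g

theorem norm_restr (g : Lp X 1 μ) {A : Set Ω} (hA : MeasurableSet A) :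
    ‖restr 𝕜 g A‖ = ‖cut 𝕜 hA g‖ := by
  rw [norm_cut, L1.norm_eq_integral_norm]
  refine integral_congr_ae ?_
  filter_upwards [restr_coeFn 𝕜 g A] with ω hω
  rw [hω]

theorem norm_restr_add_norm_restr_compl (g : Lp X 1 μ) {A : Set Ω} (hA : MeasurableSet A) :
    ‖restr 𝕜 g A‖ + ‖restr 𝕜 g Aᶜ‖ = ‖g‖ := by
  rw [norm_restr 𝕜 g hA, norm_restr 𝕜 g hA.compl, norm_cut, norm_cut,
    integral_add_compl hA (L1.integrable_coeFn g).norm, L1.norm_eq_integral_norm]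

end Cut

/-! ### An atom of finite measure gives a copy of `X` as an `ℓ_1`-summand. -/

section Atom

variable {Ω : Type*} [MeasurableSpace Ω] {μ : Measure Ω} {X : Type*} [NormedAddCommGroup X]
  {A : Set Ω}

/-- The preimage of each open set is null or conull in `A`, and countably many open sets separate
the points of the separable range. -/
theorem IsAtomOf.exists_ae_eq_const (hA : IsAtomOf μ A) {g : Ω → X} (hg : StronglyMeasurable g) :
    ∃ x, g =ᵐ[μ.restrict A] fun _ => x := by
  have := hg.isSeparable_range.secondCountableTopology
  refine Filter.exists_eventuallyEq_const_of_eventually_mem_of_forall_separating IsOpen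
    (s := range g) (.of_forall mem_range_self) fun U hU => ?_
  borelize X
  have hm : MeasurableSet (g ⁻¹' U) := hg.measurable (IsOpen.measurableSet hU)
  rcases hA.null_or_conull (A ∩ g ⁻¹' U) (hA.measurableSet.inter hm) inter_subset_left with h | h
  · right
    rw [ae_restrict_iff' hA.measurableSet, ae_iff]
    convert h using 2
    ext ω
    simp
  · left
    rw [ae_restrict_iff' hA.measurableSet, ae_iff]
    convert h using 2
    ext ω
    simp

theorem IsAtomOf.exists_Lp_ae_eq_const (hA : IsAtomOf μ A) (g : Lp X 1 (μ.restrict A)) :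
    ∃ x, g =ᵐ[μ.restrict A] fun _ => x :=
  hA.exists_ae_eq_const (Lp.stronglyMeasurable g)

theorem IsAtomOf.ae_neBot (hA : IsAtomOf μ A) : (ae (μ.restrict A)).NeBot := by
  rw [MeasureTheory.ae_neBot, Ne, Measure.restrict_eq_zero]
  exact hA.pos.ne'

theorem IsAtomOf.measureReal_pos (hA : IsAtomOf μ A) (hμA : μ A ≠ ⊤) : 0 < μ.real A :=
  ENNReal.toReal_pos hA.pos.ne' hμA

/-- On `A` the integrable function `f` is a nonzero constant. -/
theorem IsAtomInSupport.measure_ne_top {f : Lp X 1 μ} (hA : IsAtomInSupport f A) : μ A ≠ ⊤ := by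
  obtain ⟨x, hx⟩ := hA.1.exists_ae_eq_const (Lp.stronglyMeasurable f)
  have := hA.1.ae_neBot
  have hne := (ae_restrict_iff' hA.1.measurableSet).2 hA.2
  obtain ⟨ω, h1, h2⟩ := (hx.and hne).exists
  have hint : Integrable (fun _ => x) (μ.restrict A) :=
    ((L1.integrable_coeFn f).integrableOn (s := A)).congr hx
  rw [integrable_const_iff] at hint
  have h3 := (hint.resolve_left fun h => h2 (h1.trans h)).measure_univ_lt_top
  rw [Measure.restrict_apply_univ] at h3
  exact h3.ne

variable (𝕜 : Type*) [RCLike 𝕜] [NormedSpace 𝕜 X]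

theorem IsAtomInSupport.restr_ne_zero {f : Lp X 1 μ} (hA : IsAtomInSupport f A) :
    restr 𝕜 f A ≠ 0 := by
  intro h0
  have := hA.1.ae_neBot
  have hne := (ae_restrict_iff' hA.1.measurableSet).2 hA.2
  have h1 := restr_coeFn 𝕜 f A
  rw [h0] at h1
  obtain ⟨ω, ⟨h1, h2⟩, h3⟩ := ((h1.and (Lp.coeFn_zero X 1 (μ.restrict A))).and hne).exists
  exact h3 (by rw [← h1, h2]; rfl)

theorem IsAtomOf.isAtomInSupport (hA : IsAtomOf μ A) {f : Lp X 1 μ} (h0 : restr 𝕜 f A ≠ 0) :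
    IsAtomInSupport f A := by
  obtain ⟨x, hx⟩ := hA.exists_ae_eq_const (Lp.stronglyMeasurable f)
  refine ⟨hA, (ae_restrict_iff' hA.measurableSet).1 ?_⟩
  have hx0 : x ≠ 0 := by
    rintro rfl
    refine h0 (Lp.ext ?_)
    filter_upwards [restr_coeFn 𝕜 f A, hx, Lp.coeFn_zero X 1 (μ.restrict A)] with ω h1 h2 h3
    rw [h1, h2, h3]
    rfl
  filter_upwards [hx] with ω hω
  rwa [hω]

theorem atomValue_of_ae_eq_const [CompleteSpace X] {g : Lp X 1 (μ.restrict A)} {x : X}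
    (hg : g =ᵐ[μ.restrict A] fun _ => x) : atomValue 𝕜 g = ((μ.real A : ℝ) : 𝕜) • x := by
  let _ : NormedSpace ℝ X := NormedSpace.restrictScalars ℝ 𝕜 X
  have h1 : atomValue 𝕜 g = ∫ _, x ∂(μ.restrict A) := integral_congr_ae hg
  rw [h1, integral_const, measureReal_restrict_apply_univ]
  rfl

theorem norm_of_ae_eq_const {g : Lp X 1 (μ.restrict A)} {x : X}
    (hg : g =ᵐ[μ.restrict A] fun _ => x) : ‖g‖ = μ.real A * ‖x‖ := by
  rw [L1.norm_eq_integral_norm, integral_congr_ae (f := fun ω => ‖g ω‖) (g := fun _ => ‖x‖) (hg.fun_comp norm)]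
  simp

/-- The identification of `L_1(μ|_A, X)` with `X` for an atom `A` of finite measure. -/
def atomEquiv [CompleteSpace X] (hA : IsAtomOf μ A) (hμA : μ A ≠ ⊤) :
    Lp X 1 (μ.restrict A) ≃ₗᵢ[𝕜] X :=
  LinearIsometryEquiv.ofSurjective
    { toFun := fun g => atomValue 𝕜 g
      map_add' := fun g h => by
        obtain ⟨x, hx⟩ := hA.exists_Lp_ae_eq_const g
        obtain ⟨y, hy⟩ := hA.exists_Lp_ae_eq_const h
        rw [atomValue_of_ae_eq_const 𝕜 hx, atomValue_of_ae_eq_const 𝕜 hy, ← smul_add]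
        refine atomValue_of_ae_eq_const 𝕜 ?_
        filter_upwards [Lp.coeFn_add g h, hx, hy] with ω h1 h2 h3
        rw [h1, Pi.add_apply, h2, h3]
      map_smul' := fun c g => by
        obtain ⟨x, hx⟩ := hA.exists_Lp_ae_eq_const g
        rw [atomValue_of_ae_eq_const 𝕜 hx, RingHom.id_apply, smul_comm]
        refine atomValue_of_ae_eq_const 𝕜 ?_
        filter_upwards [Lp.coeFn_smul c g, hx] with ω h1 h2
        rw [h1, Pi.smul_apply, h2]
      norm_map' := fun g => by
        obtain ⟨x, hx⟩ := hA.exists_Lp_ae_eq_const g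
        change ‖atomValue 𝕜 g‖ = ‖g‖
        rw [atomValue_of_ae_eq_const 𝕜 hx, norm_of_ae_eq_const hx, norm_smul, RCLike.norm_ofReal,
          abs_of_nonneg measureReal_nonneg] }
    (fun x => by
      have hfin : IsFiniteMeasure (μ.restrict A) := ⟨by
        rw [Measure.restrict_apply_univ]; exact hμA.lt_top⟩
      have hmem : MemLp (fun _ : Ω => (((μ.real A)⁻¹ : ℝ) : 𝕜) • x) 1 (μ.restrict A) :=
        memLp_const _
      refine ⟨hmem.toLp _, ?_⟩
      change atomValue 𝕜 (hmem.toLp _) = x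
      rw [atomValue_of_ae_eq_const 𝕜 hmem.coeFn_toLp, smul_smul, ← RCLike.ofReal_mul,
        mul_inv_cancel₀ (hA.measureReal_pos hμA).ne', RCLike.ofReal_one, one_smul])

theorem atomEquiv_apply [CompleteSpace X] (hA : IsAtomOf μ A) (hμA : μ A ≠ ⊤)
    (g : Lp X 1 (μ.restrict A)) : atomEquiv 𝕜 hA hμA g = atomValue 𝕜 g :=
  rfl

/-- The map `L_1(μ, X) → X`, `g ↦ ∫_A g dμ`, for an atom `A` of finite measure. -/
def atomProj [CompleteSpace X] (hA : IsAtomOf μ A) (hμA : μ A ≠ ⊤) : Lp X 1 μ →L[𝕜] X :=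
  ((atomEquiv 𝕜 hA hμA : Lp X 1 (μ.restrict A) ≃ₗᵢ[𝕜] X).toContinuousLinearEquiv :
    Lp X 1 (μ.restrict A) →L[𝕜] X).comp
    (LpToLpRestrictCLM Ω X 𝕜 μ 1 A)

theorem atomProj_apply [CompleteSpace X] (hA : IsAtomOf μ A) (hμA : μ A ≠ ⊤) (g : Lp X 1 μ) :
    atomProj 𝕜 hA hμA g = atomValue 𝕜 (restr 𝕜 g A) :=
  rfl

/-- The map `X → L_1(μ, X)`, `x ↦ μ(A)⁻¹ 1_A x`, for a set `A` of finite measure. -/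
def atomIncl (hA : MeasurableSet A) (hμA : μ A ≠ ⊤) : X →L[𝕜] Lp X 1 μ :=
  LinearMap.mkContinuous
    { toFun := fun x => (((μ.real A)⁻¹ : ℝ) : 𝕜) • indicatorConstLp 1 hA hμA x
      map_add' := fun x y => by rw [← indicatorConstLp_add, smul_add]
      map_smul' := fun c x => by
        rw [RingHom.id_apply, smul_comm c]
        congr 1
        refine Lp.ext ?_
        filter_upwards [indicatorConstLp_coeFn (p := 1) (hs := hA) (hμs := hμA) (c := c • x),
          indicatorConstLp_coeFn (p := 1) (hs := hA) (hμs := hμA) (c := x),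
          Lp.coeFn_smul c (indicatorConstLp 1 hA hμA x)] with ω h1 h2 h3
        rw [h1, h3, Pi.smul_apply, h2]
        by_cases hω : ω ∈ A <;> simp [hω] }
    -- This constant is `0` rather than `1` when `A` is null.
    ((μ.real A)⁻¹ * μ.real A) fun x => by
      change ‖(((μ.real A)⁻¹ : ℝ) : 𝕜) • indicatorConstLp 1 hA hμA x‖ ≤ _
      rw [norm_smul, norm_indicatorConstLp one_ne_zero ENNReal.one_ne_top, RCLike.norm_ofReal,
        abs_of_nonneg (inv_nonneg.2 measureReal_nonneg)]
      simp [mul_assoc, mul_comm]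

theorem atomIncl_coeFn (hA : MeasurableSet A) (hμA : μ A ≠ ⊤) (x : X) :
    atomIncl 𝕜 hA hμA x =ᵐ[μ] A.indicator fun _ => (((μ.real A)⁻¹ : ℝ) : 𝕜) • x := by
  filter_upwards [Lp.coeFn_smul (((μ.real A)⁻¹ : ℝ) : 𝕜) (indicatorConstLp 1 hA hμA x),
    indicatorConstLp_coeFn (p := 1) (hs := hA) (hμs := hμA) (c := x)] with ω h1 h2
  change ((((μ.real A)⁻¹ : ℝ) : 𝕜) • indicatorConstLp 1 hA hμA x : Lp X 1 μ) ω = _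
  rw [h1, Pi.smul_apply, h2]
  by_cases hω : ω ∈ A <;> simp [hω]

theorem atomIncl_atomProj [CompleteSpace X] (hA : IsAtomOf μ A) (hμA : μ A ≠ ⊤) (g : Lp X 1 μ) :
    atomIncl 𝕜 hA.measurableSet hμA (atomProj 𝕜 hA hμA g) = cut 𝕜 hA.measurableSet g := by
  obtain ⟨x, hx⟩ := hA.exists_ae_eq_const (Lp.stronglyMeasurable g)
  rw [atomProj_apply, atomValue_of_ae_eq_const 𝕜 ((restr_coeFn 𝕜 g A).trans hx)]
  refine Lp.ext ?_
  rw [Filter.EventuallyEq, ae_restrict_iff' hA.measurableSet] at hx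
  filter_upwards [hx, atomIncl_coeFn 𝕜 hA.measurableSet hμA (((μ.real A : ℝ) : 𝕜) • x),
    cut_coeFn 𝕜 hA.measurableSet g] with ω h1 h2 h3
  rw [h2, h3, smul_smul, ← RCLike.ofReal_mul, inv_mul_cancel₀ (hA.measureReal_pos hμA).ne']
  by_cases hω : ω ∈ A
  · simp [hω, h1 hω]
  · simp [hω]

theorem isL1Summand_atom [CompleteSpace X] (hA : IsAtomOf μ A) (hμA : μ A ≠ ⊤) :
    IsL1Summand (atomProj 𝕜 hA hμA : Lp X 1 μ →L[𝕜] X)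
      (atomIncl 𝕜 hA.measurableSet hμA) where
  left_inv x := by
    have h1 : restr 𝕜 (atomIncl 𝕜 hA.measurableSet hμA x) A =ᵐ[μ.restrict A]
        fun _ => (((μ.real A)⁻¹ : ℝ) : 𝕜) • x := by
      refine (restr_coeFn 𝕜 _ A).trans ((ae_restrict_iff' hA.measurableSet).2 ?_)
      filter_upwards [atomIncl_coeFn 𝕜 hA.measurableSet hμA x] with ω h1 hω
      rw [h1, indicator_of_mem hω]
    rw [atomProj_apply, atomValue_of_ae_eq_const 𝕜 h1, smul_smul, ← RCLike.ofReal_mul,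
      mul_inv_cancel₀ (hA.measureReal_pos hμA).ne', RCLike.ofReal_one, one_smul]
  norm_eq g := by
    rw [atomIncl_atomProj, atomProj_apply, ← atomEquiv_apply 𝕜 hA hμA,
      LinearIsometryEquiv.norm_map, norm_restr 𝕜 g hA.measurableSet]
    exact norm_eq_norm_cut_add 𝕜 hA.measurableSet g

end Atom

/-! ### Assembling the pieces. -/

section Main

variable {Ω : Type*} [MeasurableSpace Ω] {μ : Measure Ω} {X : Type*} [NormedAddCommGroup X]

variable (𝕜 : Type*) [RCLike 𝕜] [NormedSpace 𝕜 X]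

/-- There is a decomposition of `L_1(μ, X)` by restrictions to finitely many sets, such that each
of them either is an atom in the support of `f` or carries only a small part of `f`. -/
theorem exists_isL1Decomposition_cut (f : Lp X 1 μ) {η : ℝ} (hη : 0 < η) :
    ∃ (ι : Type) (_ : Fintype ι) (P : ι → Set Ω) (hP : ∀ i, MeasurableSet (P i)),
      IsL1Decomposition (fun i => (cut 𝕜 (hP i) : Lp X 1 μ →L[𝕜] Lp X 1 μ)) ∧
      ∀ i, ‖cut 𝕜 (hP i) f‖ ≤ η ∨ IsAtomInSupport f (P i) := by
  obtain ⟨ι, _, P, hP, hd, hU, hsmall⟩ :=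
    exists_partition_atoms_small f (ENNReal.ofReal_pos.2 hη)
  refine ⟨ι, inferInstance, P, hP, isL1Decomposition_cut 𝕜 hP hd hU, fun i => ?_⟩
  refine (hsmall i).imp_left fun h => ?_
  rw [norm_cut_eq_toReal]
  exact ENNReal.toReal_le_of_le_ofReal hη.le h

theorem HasAtomlessSupport.isFinelyDecomposable {f : Lp X 1 μ} (hf : HasAtomlessSupport f) :
    IsFinelyDecomposable 𝕜 f := by
  intro η hη
  obtain ⟨ι, _, P, hP, hR, hsmall⟩ := exists_isL1Decomposition_cut 𝕜 f hη
  exact ⟨ι, inferInstance, _, hR, fun i => (hsmall i).resolve_right (hf _)⟩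

variable [CompleteSpace X]

theorem IsAtomInSupport.atomProj_ne_zero {f : Lp X 1 μ} {A : Set Ω} (hA : IsAtomInSupport f A) :
    atomProj 𝕜 hA.1 hA.measure_ne_top f ≠ 0 := by
  rw [atomProj_apply, ← atomEquiv_apply 𝕜 hA.1 hA.measure_ne_top, Ne,
    LinearIsometryEquiv.map_eq_zero_iff]
  exact hA.restr_ne_zero 𝕜

variable {𝕜} in
/-- If `h` lies above the level `c` of `Φ`, then so does some piece of `h` that can be moved far
away from `f`, provided that this is possible on the atoms in the support of `f`. -/
theorem reachesTwoAbove_of_atoms {f h : Lp X 1 μ} (hf : ‖f‖ = 1) {Φ : Lp X 1 μ →L[𝕜] 𝕜} {c : ℝ}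
    (hh : c * ‖h‖ < RCLike.re (Φ h))
    (hatom : ∀ A (hA : IsAtomInSupport f A),
      c * ‖atomProj 𝕜 hA.1 hA.measure_ne_top h‖ <
        RCLike.re (Φ.comp (atomIncl 𝕜 hA.1.measurableSet hA.measure_ne_top)
          (atomProj 𝕜 hA.1 hA.measure_ne_top h)) →
      ReachesTwoAbove (normalized 𝕜 (atomProj 𝕜 hA.1 hA.measure_ne_top f))
        (Φ.comp (atomIncl 𝕜 hA.1.measurableSet hA.measure_ne_top)) c) :
    ReachesTwoAbove f Φ c := by
  intro δ hδ
  obtain ⟨ι, _, P, hP, hR, hsmall⟩ :=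
    exists_isL1Decomposition_cut 𝕜 f (show 0 < δ / 4 by positivity)
  obtain ⟨i, hi⟩ := hR.exists_lt_of_lt hh
  rcases hsmall i with hi' | hA
  -- On a small piece `f` has norm at most `δ / 4`, so the normalized piece of `h` is at distance at
  -- least `2 - δ / 2`.
  · have h0 : cut 𝕜 (hP i) h ≠ 0 := by
      intro h0
      simp [h0] at hi
    refine ⟨normalized 𝕜 (cut 𝕜 (hP i) h), (norm_normalized h0).le,
      lt_re_apply_normalized h0 hi, ?_⟩
    have h1 := hR.le_norm_sub f (normalized 𝕜 (cut 𝕜 (hP i) h)) {i} fun j hj => by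
      rw [normalized, map_smul, hR.apply_of_ne j i (by simpa using hj), smul_zero]
    rw [hf, norm_normalized h0, Finset.sum_singleton] at h1
    linarith
  · have hs := isL1Summand_atom 𝕜 (X := X) hA.1 hA.measure_ne_top
    have hcut := atomIncl_atomProj 𝕜 (X := X) hA.1 hA.measure_ne_top
    refine hs.reachesTwoAbove_of_proj hf (hA.atomProj_ne_zero 𝕜) (hatom _ hA ?_) δ hδ
    rw [← hs.norm_incl, ContinuousLinearMap.comp_apply, hcut]
    exact hi

variable {f : Lp X 1 μ}

theorem IsAtomInSupport.atomEquiv_normalized {A : Set Ω} (hA : IsAtomInSupport f A) :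
    atomEquiv 𝕜 hA.1 hA.measure_ne_top (normalized 𝕜 (restr 𝕜 f A)) =
      normalized 𝕜 (atomProj 𝕜 hA.1 hA.measure_ne_top f) :=
  map_normalized _ _

variable {𝕜} in
theorem isDeltaPoint_of_atoms (hf : ‖f‖ = 1)
    (h : ∀ A (hA : IsAtomInSupport f A),
      IsDeltaPoint 𝕜 (normalized 𝕜 (atomProj 𝕜 hA.1 hA.measure_ne_top f))) :
    IsDeltaPoint 𝕜 f := by
  rw [isDeltaPoint_iff]
  -- Taking `f` itself as the vector to cut ensures that the slice on each relevant atom contains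
  -- the normalized restriction of `f`.
  refine ⟨hf, fun Φ c hc hcf => reachesTwoAbove_of_atoms hf (h := f) (by simpa [hf] using hcf) ?_⟩
  intro A hA hlt
  exact (isDeltaPoint_iff.1 (h A hA)).2 _ c hc
    (lt_re_apply_normalized (hA.atomProj_ne_zero 𝕜) hlt)

variable {𝕜} in
theorem isDaugavetPoint_of_atoms (hf : ‖f‖ = 1)
    (h : ∀ A (hA : IsAtomInSupport f A),
      IsDaugavetPoint 𝕜 (normalized 𝕜 (atomProj 𝕜 hA.1 hA.measure_ne_top f))) :
    IsDaugavetPoint 𝕜 f := by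
  rw [isDaugavetPoint_iff]
  refine ⟨hf, fun Φ c hc hcΦ => ?_⟩
  obtain ⟨g, hg, hcg⟩ := exists_lt_re_apply hcΦ
  refine reachesTwoAbove_of_atoms hf ((mul_le_of_le_one_right hc.le hg).trans_lt hcg) ?_
  intro A hA hlt
  exact (isDaugavetPoint_iff.1 (h A hA)).2 _ c hc (IsL1Summand.lt_norm_comp_incl hlt)

end Main

end Diametral

end

open Diametral in
theorem mainTheorem12 {𝕜 : Type*} [RCLike 𝕜]
    {Ω : Type*} [MeasurableSpace Ω] (μ : Measure Ω)
    {X : Type*} [NormedAddCommGroup X] [NormedSpace 𝕜 X] [CompleteSpace X]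
    (f : Lp X 1 μ) (hf : ‖f‖ = 1) :
    -- the identification `L_1(μ|_A, X) = X` for an atom `A` of finite measure
    (∀ A : Set Ω, IsAtomOf μ A → μ A ≠ ⊤ →
      ∃ Φ : Lp X 1 (μ.restrict A) ≃ₗᵢ[𝕜] X, ∀ g, Φ g = atomValue 𝕜 g) ∧
    -- atomless support
    (HasAtomlessSupport f → IsSuperDaugavetPoint 𝕜 f ∧ IsCCSDeltaPoint 𝕜 f) ∧
    -- support with atoms; each condition is stated both in `L_1(μ|_A, X)` and in `X`
    (¬ HasAtomlessSupport f →
      [ IsDeltaPoint 𝕜 f,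
        ∀ A, IsAtomInSupport f A → IsDeltaPoint 𝕜 (normalized 𝕜 (restr 𝕜 f A)),
        ∀ A, IsAtomInSupport f A →
          IsDeltaPoint 𝕜 (atomValue 𝕜 (normalized 𝕜 (restr 𝕜 f A))) ].TFAE ∧
      [ IsDaugavetPoint 𝕜 f,
        ∀ A, IsAtomInSupport f A → IsDaugavetPoint 𝕜 (normalized 𝕜 (restr 𝕜 f A)),
        ∀ A, IsAtomInSupport f A →
          IsDaugavetPoint 𝕜 (atomValue 𝕜 (normalized 𝕜 (restr 𝕜 f A))) ].TFAE ∧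
      -- `RCLike.I = 0` says that the scalar field is real
      ((RCLike.I : 𝕜) = 0 →
        [ IsNablaPoint 𝕜 f,
          IsDaugavetPoint 𝕜 f ∨
            ∃ A, IsAtomOf μ A ∧ restr 𝕜 f Aᶜ = 0 ∧ IsNablaPoint 𝕜 (restr 𝕜 f A),
          IsDaugavetPoint 𝕜 f ∨
            ∃ A, IsAtomOf μ A ∧ restr 𝕜 f Aᶜ = 0 ∧
              IsNablaPoint 𝕜 (atomValue 𝕜 (restr 𝕜 f A)) ].TFAE)) := by
  refine ⟨fun A hA hμA => ⟨atomEquiv 𝕜 hA hμA, atomEquiv_apply 𝕜 hA hμA⟩,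
    fun h => ⟨(h.isFinelyDecomposable 𝕜).isSuperDaugavetPoint hf,
      (h.isFinelyDecomposable 𝕜).isCCSDeltaPoint hf⟩, fun _ => ⟨?_, ?_, fun _ => ?_⟩⟩
  · tfae_have 1 → 3 := fun h A hA => by
      rw [← atomEquiv_apply 𝕜 hA.1 hA.measure_ne_top, hA.atomEquiv_normalized 𝕜]
      exact (isL1Summand_atom 𝕜 hA.1 hA.measure_ne_top).isDeltaPoint_proj
        (hA.atomProj_ne_zero 𝕜) h
    tfae_have 3 → 2 := fun h A hA => by
      simpa [← atomEquiv_apply 𝕜 hA.1 hA.measure_ne_top] using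
        (h A hA).map (atomEquiv 𝕜 hA.1 hA.measure_ne_top).symm
    tfae_have 2 → 1 := fun h => isDeltaPoint_of_atoms hf fun A hA => by
      rw [← hA.atomEquiv_normalized 𝕜]
      exact (h A hA).map _
    tfae_finish
  · tfae_have 1 → 3 := fun h A hA => by
      rw [← atomEquiv_apply 𝕜 hA.1 hA.measure_ne_top, hA.atomEquiv_normalized 𝕜]
      exact (isL1Summand_atom 𝕜 hA.1 hA.measure_ne_top).isDaugavetPoint_proj
        (hA.atomProj_ne_zero 𝕜) h
    tfae_have 3 → 2 := fun h A hA => by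
      simpa [← atomEquiv_apply 𝕜 hA.1 hA.measure_ne_top] using
        (h A hA).map (atomEquiv 𝕜 hA.1 hA.measure_ne_top).symm
    tfae_have 2 → 1 := fun h => isDaugavetPoint_of_atoms hf fun A hA => by
      rw [← hA.atomEquiv_normalized 𝕜]
      exact (h A hA).map _
    tfae_finish
  · tfae_have 1 → 3 := fun h => by
      refine or_iff_not_imp_left.2 fun hD => ?_
      -- An atom where the Daugavet property fails must carry the full norm of `f`, so `f` vanishes
      -- off it.
      obtain ⟨A, hA, hAD⟩ : ∃ A, ∃ hA : IsAtomInSupport f A,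
          ¬ IsDaugavetPoint 𝕜 (normalized 𝕜 (atomProj 𝕜 hA.1 hA.measure_ne_top f)) := by
        by_contra! hall
        exact hD (isDaugavetPoint_of_atoms hf hall)
      have hs := isL1Summand_atom 𝕜 (X := X) hA.1 hA.measure_ne_top
      have h1 : ‖atomProj 𝕜 hA.1 hA.measure_ne_top f‖ = 1 := by
        refine le_antisymm ((hs.norm_proj_le f).trans_eq hf) (not_lt.1 fun hlt => hAD ?_)
        exact hs.isDaugavetPoint_proj_of_isNablaPoint (hA.atomProj_ne_zero 𝕜) hlt h
      refine ⟨A, hA.1, ?_, hs.isNablaPoint_proj h1 h⟩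
      rw [atomProj_apply, ← atomEquiv_apply 𝕜 hA.1 hA.measure_ne_top,
        LinearIsometryEquiv.norm_map] at h1
      have h2 := norm_restr_add_norm_restr_compl 𝕜 f hA.1.measurableSet
      rw [h1, hf] at h2
      exact norm_eq_zero.1 (by linarith)
    have hsupp : ∀ A, IsAtomOf μ A → restr 𝕜 f Aᶜ = 0 → IsAtomInSupport f A := by
      intro A hA h0
      refine hA.isAtomInSupport 𝕜 (norm_ne_zero_iff.1 ?_)
      have h2 := norm_restr_add_norm_restr_compl 𝕜 f hA.measurableSet
      rw [h0, norm_zero, add_zero, hf] at h2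
      rw [h2]
      exact one_ne_zero
    tfae_have 3 → 2 := by
      rintro (hD | ⟨A, hA, h0, h⟩)
      · exact Or.inl hD
      · refine Or.inr ⟨A, hA, h0, ?_⟩
        have hμA := (hsupp A hA h0).measure_ne_top
        simpa [← atomEquiv_apply 𝕜 hA hμA] using h.map (atomEquiv 𝕜 hA hμA).symm
    tfae_have 2 → 1 := by
      rintro (hD | ⟨A, hA, h0, h⟩)
      · exact hD.isNablaPoint
      · have hμA := (hsupp A hA h0).measure_ne_top
        exact (isL1Summand_atom 𝕜 hA hμA).isNablaPoint_of_proj hf (h.map (atomEquiv 𝕜 hA hμA))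
    tfae_finish
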